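/- **Setting.** Let $\mathcal H$ be a real reproducing kernel Hilbert space of dimension $d$ on a set $\mathcal X$, with kernel $k$, $k_x=k(\cdot,x)$, and let $\phi=(\phi_1,\dots,\phi_d)$ be an orthonormal basis of $\mathcal H$, so that each $f\in\mathcal H$ is $f=\langle\phi,\theta\rangle$ with coefficient vector $\theta\in\mathbb R^d$ and $\|f\|_{\mathcal H}=\|\theta\|$. There are $M\ge1$ clients; client $i$ holds data $(x_{ij},y_{ij})$, $1\le j\le n_i$, with $y_{ij}=f_i^*(x_{ij})+\xi_{ij}$, where $f_i^*\in\mathcal H$ has coefficients $\theta_i^*$. The covariates are random and, conditionally on them, the noise variables $\xi_{ij}$ are independent, centred, with variance at most $\sigma^2$; $\mathbb E_\xi$ is the expectation over the noise only. Put $N=\sum_i n_i$, $w_i=n_i/N$, $\Gamma=\max_{i,j}\|\theta_i^*-\theta_j^*\|$, $\ell_i(f)=\frac1{2n_i}\sum_j(f(x_{ij})-y_{ij})^2$. From an initial $f_0\in\mathcal H$ and with stepsize $\eta>0$, the global model is $f_t=\sum_i w_i f_{i,t}$, where for FedAvg $f_{i,t}=\mathcal G_i^s(f_{t-1})$ with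 $\mathcal G_i(f)=f-\eta\nabla\ell_i(f)$ and $s\ge1$, and for FedProx $f_{i,t}=\arg\min_f\{\ell_i(f)+\frac1{2\eta}\|f-f_{t-1}\|_{\mathcal H}^2\}$ (put $s=1$ in this case). Let $\theta_t$ be the coefficients of $f_t$. Let $\mathcal T_if=\frac1{n_i}\sum_j f(x_{ij})k_{x_{ij}}$ and $$\mathcal L=\sum_i w_i(I-\eta\mathcal T_i)^s,\quad \Psi_{ij}=\frac{\eta}{n_i}\sum_{\tau=0}^{s-1}(I-\eta\mathcal T_i)^\tau k_{x_{ij}}\quad\text{(FedAvg)},$$ $$\mathcal L=\sum_i w_i(I+\eta\mathcal T_i)^{-1},\quad \Psi_{ij}=\frac{\eta}{n_i}(I+\eta\mathcal T_i)^{-1}k_{x_{ij}}\quad\text{(FedProx)},$$ and, when $I-\mathcal L$ is invertible, let $\bar\theta$ be the coefficients of $\bar f=(I-\mathcal L)^{-1}\sum_i w_i\sum_j f_i^*(x_{ij})\Psi_{ij}$. Let $\gamma=\eta\max_i\|K_{\mathbf x_i}\|$, where $K_{\mathbf x_i}=\frac1{n_i}(k(x_{ij},x_{il}))_{j,l}$;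 for FedAvg assume $\gamma<1$ almost surely. Let $\kappa=\frac{\gamma s}{1-(1-\gamma)^s}$ for FedAvg and $\kappa=1+\gamma$ for FedProx. **Subspace model.** Let $r_i\ge1$ and suppose that almost surely the $n_i\times d$ matrix $\phi(\mathbf x_i)$ with rows $\phi(x_{ij})^\top$ equals $\sqrt{d/r_i}\,F_iU_i^\top$, where $U_i$ is a random $d\times r_i$ matrix with orthonormal columns, the subspaces spanned by the columns of $U_1,\dots,U_M$ are independent, and $\mathbb E[U_iU_i^\top]=\frac{r_i}{d}I_d$. Suppose that $\alpha,\beta>0$ and that almost surely $\lambda_{\min}(F_i^\top F_i/n_i)\ge\alpha$ and $\|F_i^\top F_i/n_i\|\le\beta$ for all $i$. **Statement.** There is a universal constant $C>0$ such that, if $N\ge C\nu d\log d$ with $\nu=\max_i n_i/r_i$, then with probability at least $1-1/d$ over the covariates the operator $I-\mathcal L$ is invertible, for all $t\ge0$ $$\mathbb E_\xi\|\theta_t-\bar\theta\|^2\le\Big(1-\frac{s\eta\alpha}{2\kappa}\Big)^{2t}\|\theta_0-\bar\theta\|^2+\sigma^2\frac{2\kappa d}{N\alpha},$$ and for all $j\in\{1,\dots,M\}$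 $$\|\bar\theta-\theta_j^*\|\le\Gamma\sqrt{\frac{2\kappa\beta\nu Md}{\alpha N}}.$$ -/

import Mathlib

set_option pp.deepTerms true

open MeasureTheory ProbabilityTheory

namespace FedLearn

/-- The two federated algorithms: FedAvg with `s` local gradient steps per round, and FedProx. -/
inductive Algorithm
  | fedAvg (s : ℕ)
  | fedProx

/-- The parameter `s` of the unified statement: the number of local steps for FedAvg,
and `1` for FedProx. -/
def Algorithm.localSteps : Algorithm → ℕ
  | .fedAvg s => s
  | .fedProx => 1

/-- `κ = γ s / (1 - (1 - γ) ^ s)` for FedAvg and `κ = 1 + γ` for FedProx. -/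
noncomputable def Algorithm.kappa (γ : ℝ) : Algorithm → ℝ
  | .fedAvg s => γ * s / (1 - (1 - γ) ^ s)
  | .fedProx => 1 + γ

/-- The spectral norm of a square real matrix, i.e. its operator norm on Euclidean space. -/
noncomputable def specNorm {m : ℕ} (A : Matrix (Fin m) (Fin m) ℝ) : ℝ :=
  ‖Matrix.toEuclideanCLM (n := Fin m) (𝕜 := ℝ) A‖

/-- The smallest (real) eigenvalue of a square matrix; used for symmetric matrices only. -/
noncomputable def minEigenvalue {m : ℕ} (A : Matrix (Fin m) (Fin m) ℝ) : ℝ :=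
  sInf (spectrum ℝ A)

/-- A minimizer of `J` (an arbitrary element if there is none). -/
noncomputable def argmin {H : Type*} [Nonempty H] (J : H → ℝ) : H :=
  Classical.epsilon fun f => IsMinOn J Set.univ f

section RKHS

variable {X H : Type*} [NormedAddCommGroup H] [InnerProductSpace ℝ H] [CompleteSpace H]
  [RKHS ℝ H X ℝ]

variable (H) in
/-- The representer `k_x = k(·, x)` of the evaluation at `x`. -/
noncomputable def rep (x : X) : H := RKHS.kerFun H x (1 : ℝ)

/-! ### One client with `m` data points -/

variable (H) in
/-- The normalized Gram matrix `(1/m) k(x_j, x_l)`. -/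
noncomputable def gram {m : ℕ} (x : Fin m → X) : Matrix (Fin m) (Fin m) ℝ :=
  Matrix.of fun j l => (1 / (m : ℝ)) * (rep H (x l)) (x j)

/-- The matrix `φ(x)` whose `j`-th row is the feature vector of `x_j`; the feature map consists of
the elements of an orthonormal basis of `H`, evaluated at the given point. -/
noncomputable def featureMatrix {d m : ℕ} (b : OrthonormalBasis (Fin d) ℝ H) (x : Fin m → X) :
    Matrix (Fin m) (Fin d) ℝ :=
  Matrix.of fun j l => (b l) (x j)

/-- The local empirical risk. -/
noncomputable def empRisk {m : ℕ} (x : Fin m → X) (y : Fin m → ℝ) (f : H) : ℝ :=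
  (1 / (2 * (m : ℝ))) * ∑ j, (f (x j) - y j) ^ 2

/-- One step of local gradient descent with stepsize `η` (gradient in `H`). -/
noncomputable def gradStep (η : ℝ) {m : ℕ} (x : Fin m → X) (y : Fin m → ℝ) (f : H) : H :=
  f - η • gradient (empRisk (H := H) x y) f

/-- The local objective of FedProx at the current global model `g`. -/
noncomputable def proxObjective (η : ℝ) {m : ℕ} (x : Fin m → X) (y : Fin m → ℝ) (g f : H) : ℝ :=
  empRisk x y f + (1 / (2 * η)) * ‖f - g‖ ^ 2

/-- The model that a client returns when it receives the global model `g`. -/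
noncomputable def localUpdate (alg : Algorithm) (η : ℝ) {m : ℕ} (x : Fin m → X) (y : Fin m → ℝ)
    (g : H) : H :=
  match alg with
  | .fedAvg s => (gradStep η x y)^[s] g
  | .fedProx => argmin (proxObjective η x y g)

variable (H) in
/-- The operator `f ↦ (1/m) ∑ j, f(x_j) k_{x_j}`. -/
noncomputable def sampleOp {m : ℕ} (x : Fin m → X) : Module.End ℝ H where
  toFun f := (1 / (m : ℝ)) • ∑ j, f (x j) • rep H (x j)
  map_add' f g := by simp [add_smul, Finset.sum_add_distrib]
  map_smul' c f := by
    simp only [RKHS.coe_smul, Pi.smul_apply, smul_eq_mul, mul_smul, ← Finset.smul_sum,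
      RingHom.id_apply]
    rw [smul_comm]

variable (H) in
/-- The contribution of one client to the operator `L`: with `T` the sample operator,
`(1 - η T) ^ s` for FedAvg and `(1 + η T)⁻¹` for FedProx. -/
noncomputable def clientOp (alg : Algorithm) (η : ℝ) {m : ℕ} (x : Fin m → X) : Module.End ℝ H :=
  match alg with
  | .fedAvg s => (1 - η • sampleOp H x) ^ s
  | .fedProx => Ring.inverse (1 + η • sampleOp H x)

variable (H) in
/-- The `j`-th component of `Ψ_i`: with `T` the sample operator,
`(η/m) ∑_{τ<s} (1 - η T)^τ k_{x_j}` for FedAvg and `(η/m) (1 + η T)⁻¹ k_{x_j}` for FedProx. -/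
noncomputable def clientPsi (alg : Algorithm) (η : ℝ) {m : ℕ} (x : Fin m → X) (j : Fin m) : H :=
  match alg with
  | .fedAvg s => (η / m) • ∑ τ ∈ Finset.range s, ((1 - η • sampleOp H x) ^ τ) (rep H (x j))
  | .fedProx => (η / m) • (Ring.inverse (1 + η • sampleOp H x)) (rep H (x j))

/-! ### The whole system of `M` clients, client `i` having `n i` data points -/

/-- The weight `w_i = n_i / N`, where `N = ∑ i, n_i`. -/
noncomputable def weight {M : ℕ} (n : Fin M → ℕ) (i : Fin M) : ℝ :=
  (n i : ℝ) / ((∑ l, n l : ℕ) : ℝ)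

/-- The global model after `t` communication rounds, started from `f₀`. -/
noncomputable def globalModel (alg : Algorithm) (η : ℝ) {M : ℕ} {n : Fin M → ℕ}
    (x : (i : Fin M) → Fin (n i) → X) (y : (i : Fin M) → Fin (n i) → ℝ) (f₀ : H) : ℕ → H
  | 0 => f₀
  | t + 1 => ∑ i, weight n i • localUpdate alg η (x i) (y i) (globalModel alg η x y f₀ t)

variable (H) in
/-- The operator `L` that governs the dynamics of the global model. -/
noncomputable def globalOp (alg : Algorithm) (η : ℝ) {M : ℕ} {n : Fin M → ℕ}
    (x : (i : Fin M) → Fin (n i) → X) : Module.End ℝ H :=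
  ∑ i, weight n i • clientOp H alg η (x i)

variable (H) in
/-- The element `v · Ψ` of `H`, where `Ψ = (w_1 Ψ_1, …, w_M Ψ_M)`. -/
noncomputable def dotPsi (alg : Algorithm) (η : ℝ) {M : ℕ} {n : Fin M → ℕ}
    (x : (i : Fin M) → Fin (n i) → X) (v : (i : Fin M) → Fin (n i) → ℝ) : H :=
  ∑ i, weight n i • ∑ j, v i j • clientPsi H alg η (x i) j

/-- `f̄ = (1 - L)⁻¹ ((f_1^*(x_1), …, f_M^*(x_M)) · Ψ)`, meaningful when `1 - L` is invertible. -/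
noncomputable def fBar (alg : Algorithm) (η : ℝ) {M : ℕ} {n : Fin M → ℕ}
    (x : (i : Fin M) → Fin (n i) → X) (fStar : Fin M → H) : H :=
  (Ring.inverse (1 - globalOp H alg η x)) (dotPsi H alg η x fun i j => (fStar i) (x i j))

variable (H) in
/-- `γ = η max_i ‖K_{x_i}‖`. -/
noncomputable def gammaOf (η : ℝ) {M : ℕ} {n : Fin M → ℕ} (x : (i : Fin M) → Fin (n i) → X) : ℝ :=
  η * ⨆ i, specNorm (gram H (x i))

/-- The responses `y_ij = f_i^*(x_ij) + ξ_ij`. -/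
noncomputable def responses {M : ℕ} {n : Fin M → ℕ} (x : (i : Fin M) → Fin (n i) → X)
    (fStar : Fin M → H) (ξ : (Σ i : Fin M, Fin (n i)) → ℝ) : (i : Fin M) → Fin (n i) → ℝ :=
  fun i j => (fStar i) (x i j) + ξ ⟨i, j⟩

/-- The model heterogeneity `Γ = max_{i,j} ‖f_i^* - f_j^*‖`. -/
noncomputable def modelGap {M : ℕ} (fStar : Fin M → H) : ℝ :=
  ⨆ p : Fin M × Fin M, ‖fStar p.1 - fStar p.2‖

/-- The subspace model: `φ(x_i) = √(d / r_i) F_i U_iᵀ` almost surely, where `U_i` is a random `d × r_i`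
matrix with orthonormal columns, and the random subspaces spanned by the columns of the `U_i`, given
by their orthogonal projections `U_i U_iᵀ`, are independent with `E[U_i U_iᵀ] = (r_i / d) I`.
The coefficient matrices `F_i` may be deterministic or random. -/
structure IsSubspaceModel {Ω : Type*} [MeasurableSpace Ω] (μ : Measure Ω) {d M : ℕ}
    {n r : Fin M → ℕ} (b : OrthonormalBasis (Fin d) ℝ H) (x : Ω → (i : Fin M) → Fin (n i) → X)
    (U : (i : Fin M) → Ω → Matrix (Fin d) (Fin (r i)) ℝ)
    (F : (i : Fin M) → Ω → Matrix (Fin (n i)) (Fin (r i)) ℝ) : Prop where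
  measurable : ∀ i k l, Measurable fun ω => U i ω k l
  orthonormal : ∀ᵐ ω ∂μ, ∀ i, (U i ω).transpose * U i ω = 1
  factor : ∀ᵐ ω ∂μ, ∀ i, featureMatrix b (x ω i) =
    √((d : ℝ) / (r i : ℝ)) • (F i ω * (U i ω).transpose)
  indep : iIndepFun (fun i ω (p : Fin d × Fin d) => (U i ω * (U i ω).transpose) p.1 p.2) μ
  isotropic : ∀ i k l, ∫ ω, (U i ω * (U i ω).transpose) k l ∂μ =
    (((r i : ℝ) / (d : ℝ)) • (1 : Matrix (Fin d) (Fin d) ℝ)) k l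

end RKHS

/-- The conditioning assumption `λ_min(Fᵀ F / n) ≥ α` and `‖Fᵀ F / n‖ ≤ β` on an `n × r` matrix. -/
def IsConditioned (α β : ℝ) {n r : ℕ} (F : Matrix (Fin n) (Fin r) ℝ) : Prop :=
  α ≤ minEigenvalue ((1 / (n : ℝ)) • (F.transpose * F)) ∧
    specNorm ((1 / (n : ℝ)) • (F.transpose * F)) ≤ β

/-- The law `P` of the noise vector makes the coordinates independent, centred, and of variance at
most `σ²`. -/
structure IsNoiseLaw {ι : Type*} (σ : ℝ) (P : Measure (ι → ℝ)) : Prop where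
  indep : iIndepFun (fun (p : ι) (ξ : ι → ℝ) => ξ p) P
  memLp : ∀ p, MemLp (fun ξ : ι → ℝ => ξ p) 2 P
  mean : ∀ p, ∫ ξ, ξ p ∂P = 0
  var : ∀ p, variance (fun ξ : ι → ℝ => ξ p) P ≤ σ ^ 2

end FedLearn

/-!
One communication round is affine in the model: client `i` moves it by `η T_i A_i` towards its own
data, where `T_i` is the sample operator and the filter `A_i` is a function of `T_i`, so that
`1 - L = ∑ w_i η T_i A_i`. Read off in an eigenbasis of `T_i`, the filter lies between `s / κ` and
`s`. Hence a lower bound `α / 2` for the averaged operator `∑ w_i T_i` makes `1 - L` at least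
`ρ = s η α / (2 κ)`. This gives the contraction, and the noise injected over the rounds sums to a
geometric series. For the bias, `f̄ - f_j^*` is the weighted mean of the `f_i^* - f_j^*` with
respect to the positive operators `w_i (1 - L_i)`, hence has no larger energy than they have.

The lower bound is a matrix Chernoff bound for `S = ∑ c_i U_i U_iᵀ`, where `c_i = w_i d / r_i` and
`E S = 1`. The derivative of `θ ↦ E tr exp (-θ S)` is a sum of terms `-c_i E tr (P_i exp (-θ S))`.
Replacing `P_i` in front of the exponential by an independent copy turns such a term into a multiple
of `E tr exp (-θ S)`, and the monotonicity of the exponential under the trace controls the error of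
the exchange, so that neither Lieb's theorem nor the Golden-Thompson inequality is needed. Markov's
inequality and the choice `θ = 1 / (2 R)`, with `R = ν d / N` a bound for the `c_i`, conclude.
-/

namespace FedLearn

open Matrix
open scoped InnerProductSpace

section TraceExponential

variable {n : Type*} [Fintype n] [DecidableEq n]

@[fun_prop]
theorem continuous_matrix_exp : Continuous fun A : Matrix n n ℝ => NormedSpace.exp A := by
  let _ : NormedRing (Matrix n n ℝ) := Matrix.linftyOpNormedRing
  let _ : NormedAlgebra ℝ (Matrix n n ℝ) := Matrix.linftyOpNormedAlgebra
  let _ : NormedAlgebra ℚ (Matrix n n ℝ) := NormedAlgebra.restrictScalars ℚ ℝ _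
  exact NormedSpace.exp_continuous

theorem exists_orthogonal_diagonal {A : Matrix n n ℝ} (hA : A.IsHermitian) :
    ∃ (U : Matrix n n ℝ) (a : n → ℝ), Uᵀ * U = 1 ∧ A = U * diagonal a * Uᵀ := by
  refine ⟨hA.eigenvectorUnitary, hA.eigenvalues, ?_, ?_⟩
  · simpa [star_eq_conjTranspose] using Unitary.coe_star_mul_self hA.eigenvectorUnitary
  · conv_lhs => rw [hA.spectral_theorem]
    simp [Unitary.conjStarAlgAut_apply, star_eq_conjTranspose]

theorem exp_conj_diagonal {U : Matrix n n ℝ} (hU : Uᵀ * U = 1) (a : n → ℝ) :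
    NormedSpace.exp (U * diagonal a * Uᵀ) = U * diagonal (fun k => Real.exp (a k)) * Uᵀ := by
  have hinv : U⁻¹ = Uᵀ := Matrix.inv_eq_left_inv hU
  have hu : IsUnit U := ⟨⟨U, Uᵀ, mul_eq_one_comm.mp hU, hU⟩, rfl⟩
  rw [← hinv, Matrix.exp_conj _ _ hu, Matrix.exp_diagonal]
  congr 3
  funext k
  rw [Pi.coe_exp, Real.exp_eq_exp_ℝ]

theorem smul_conj_diagonal (U : Matrix n n ℝ) (a : n → ℝ) (c : ℝ) :
    c • (U * diagonal a * Uᵀ) = U * diagonal (fun k => c * a k) * Uᵀ := by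
  rw [← smul_mul_assoc, ← mul_smul_comm, ← diagonal_smul]
  rfl

theorem conj_diagonal_mul_conj_diagonal {U : Matrix n n ℝ} (hU : Uᵀ * U = 1) (a b : n → ℝ) :
    U * diagonal a * Uᵀ * (U * diagonal b * Uᵀ) = U * diagonal (fun k => a k * b k) * Uᵀ := by
  simp only [← diagonal_mul_diagonal, Matrix.mul_assoc]
  rw [← Matrix.mul_assoc Uᵀ U, hU, Matrix.one_mul]

theorem trace_conj_diagonal {U : Matrix n n ℝ} (hU : Uᵀ * U = 1) (a : n → ℝ) :
    trace (U * diagonal a * Uᵀ) = ∑ k, a k := by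
  rw [trace_mul_comm, ← Matrix.mul_assoc, hU, Matrix.one_mul, trace_diagonal]

theorem trace_transpose_mul_of_orthogonal {U V : Matrix n n ℝ} (hU : Uᵀ * U = 1)
    (hV : Vᵀ * V = 1) (X Y : Matrix n n ℝ) :
    trace (Xᵀ * Y) = ∑ l, ∑ k, (Vᵀ * X * U) k l * (Vᵀ * Y * U) k l := by
  have hU' : U * Uᵀ = 1 := mul_eq_one_comm.mp hU
  have hV' : V * Vᵀ = 1 := mul_eq_one_comm.mp hV
  calc trace (Xᵀ * Y) = trace ((Vᵀ * X * U)ᵀ * (Vᵀ * Y * U)) := by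
        simp only [transpose_mul, transpose_transpose, Matrix.mul_assoc]
        rw [← Matrix.mul_assoc V, hV', Matrix.one_mul, trace_mul_comm Uᵀ]
        simp only [Matrix.mul_assoc, hU', Matrix.mul_one]
    _ = _ := rfl

theorem conj_diagonal_sub_apply {U V : Matrix n n ℝ} (hU : Uᵀ * U = 1) (hV : Vᵀ * V = 1)
    (a b : n → ℝ) (k l : n) :
    (Vᵀ * (U * diagonal a * Uᵀ - V * diagonal b * Vᵀ) * U) k l =
      (a l - b k) * (Vᵀ * U) k l := by
  have h : Vᵀ * (U * diagonal a * Uᵀ - V * diagonal b * Vᵀ) * U =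
      Vᵀ * U * diagonal a - diagonal b * (Vᵀ * U) := by
    simp only [Matrix.mul_sub, Matrix.sub_mul, Matrix.mul_assoc, hU, Matrix.mul_one]
    rw [← Matrix.mul_assoc Vᵀ V, hV, Matrix.one_mul]
  rw [h, Matrix.sub_apply, mul_diagonal, diagonal_mul]
  ring

theorem two_sub_mul_exp_le {x : ℝ} (hx : 0 ≤ x) : (2 - x) * Real.exp x ≤ 2 + x := by
  have hderiv (y : ℝ) : HasDerivAt (fun y => 2 + y - (2 - y) * Real.exp y)
      (1 - (1 - y) * Real.exp y) y := by
    refine (((hasDerivAt_id y).const_add 2).sub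
      (((hasDerivAt_id y).const_sub 2).mul (Real.hasDerivAt_exp y))).congr_deriv ?_
    simp only [id]
    ring
  have hmono : Monotone fun y : ℝ => 2 + y - (2 - y) * Real.exp y := by
    refine monotone_of_deriv_nonneg (fun y => (hderiv y).differentiableAt) fun y => ?_
    have h : 1 - y ≤ Real.exp (-y) := by linarith [Real.add_one_le_exp (-y)]
    rw [(hderiv y).deriv, sub_nonneg, ← le_div_iff₀ (Real.exp_pos y), one_div, ← Real.exp_neg]
    exact h
  have h := hmono hx
  simp only [sub_zero, Real.exp_zero] at h
  linarith

theorem sub_mul_exp_sub_exp_le (a b : ℝ) :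
    (a - b) * (Real.exp a - Real.exp b) ≤ 1 / 2 * ((a - b) ^ 2 * (Real.exp a + Real.exp b)) := by
  wlog h : b ≤ a generalizing a b
  · linarith [this b a (le_of_not_ge h)]
  have hdiff : Real.exp a - Real.exp b ≤ 1 / 2 * ((a - b) * (Real.exp a + Real.exp b)) := by
    have h1 := mul_le_mul_of_nonneg_right (two_sub_mul_exp_le (sub_nonneg.mpr h))
      (Real.exp_pos b).le
    rw [mul_assoc, ← Real.exp_add, sub_add_cancel] at h1
    linarith
  linarith [mul_le_mul_of_nonneg_left hdiff (sub_nonneg.mpr h)]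

-- In the pair of eigenbases of `A` and `B` both sides are sums of `(Vᵀ U)²` times the scalar case.
theorem trace_sub_mul_exp_sub_exp_le {A B : Matrix n n ℝ} (hA : A.IsHermitian)
    (hB : B.IsHermitian) :
    trace ((A - B) * (NormedSpace.exp A - NormedSpace.exp B)) ≤
      1 / 2 * trace ((A - B) * (A - B) * (NormedSpace.exp A + NormedSpace.exp B)) := by
  have hD : (A - B)ᵀ = A - B := by simpa using (hA.sub hB).eq
  have hcycle : trace ((A - B) * (A - B) * (NormedSpace.exp A + NormedSpace.exp B)) =
      trace ((A - B)ᵀ * ((A - B) * NormedSpace.exp A)) +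
        trace ((A - B)ᵀ * (NormedSpace.exp B * (A - B))) := by
    rw [hD, Matrix.mul_add, trace_add, ← Matrix.mul_assoc, trace_mul_comm (A - B) (_ * _),
      Matrix.mul_assoc (NormedSpace.exp B), trace_mul_comm (NormedSpace.exp B)]
  rw [hcycle]
  nth_rw 1 [← hD]
  clear hcycle hD
  obtain ⟨U, a, hU, rfl⟩ := exists_orthogonal_diagonal hA
  obtain ⟨V, b, hV, rfl⟩ := exists_orthogonal_diagonal hB
  set D := U * diagonal a * Uᵀ - V * diagonal b * Vᵀ
  have hexpA (k l : n) : (Vᵀ * (D * (U * diagonal (fun i => Real.exp (a i)) * Uᵀ)) * U) k l =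
      (a l - b k) * (Vᵀ * U) k l * Real.exp (a l) := by
    have h : Vᵀ * (D * (U * diagonal (fun i => Real.exp (a i)) * Uᵀ)) * U =
        Vᵀ * D * U * diagonal (fun i => Real.exp (a i)) := by
      simp only [Matrix.mul_assoc, hU, Matrix.mul_one]
    rw [h, mul_diagonal, conj_diagonal_sub_apply hU hV]
  have hexpB (k l : n) : (Vᵀ * (V * diagonal (fun i => Real.exp (b i)) * Vᵀ * D) * U) k l =
      Real.exp (b k) * ((a l - b k) * (Vᵀ * U) k l) := by
    have h : Vᵀ * (V * diagonal (fun i => Real.exp (b i)) * Vᵀ * D) * U =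
        diagonal (fun i => Real.exp (b i)) * (Vᵀ * D * U) := by
      simp only [← Matrix.mul_assoc, hV, Matrix.one_mul]
    rw [h, diagonal_mul, conj_diagonal_sub_apply hU hV]
  simp only [exp_conj_diagonal hU, exp_conj_diagonal hV, trace_transpose_mul_of_orthogonal hU hV,
    hexpA, hexpB]
  simp only [D, conj_diagonal_sub_apply hU hV, ← Finset.sum_add_distrib, Finset.mul_sum]
  refine Finset.sum_le_sum fun l _ => Finset.sum_le_sum fun k _ => ?_
  linarith [mul_le_mul_of_nonneg_right (sub_mul_exp_sub_exp_le (a l) (b k))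
    (sq_nonneg ((Vᵀ * U) k l))]

theorem trace_mul_exp_nonneg {P A : Matrix n n ℝ} (hP : IsStarProjection P)
    (hA : A.IsHermitian) : 0 ≤ trace (P * NormedSpace.exp A) := by
  obtain ⟨U, a, hU, rfl⟩ := exists_orthogonal_diagonal hA
  have hPt : Pᵀ = P := by simpa [star_eq_conjTranspose] using hP.isSelfAdjoint.star_eq
  have h : trace (P * (U * diagonal (fun k => Real.exp (a k)) * Uᵀ)) =
      trace (diagonal (fun k => Real.exp (a k)) * ((P * U)ᵀ * (P * U))) := by
    rw [transpose_mul, hPt, Matrix.mul_assoc Uᵀ, ← Matrix.mul_assoc P P,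
      hP.isIdempotentElem.eq, Matrix.mul_assoc U, ← Matrix.mul_assoc P, trace_mul_comm,
      Matrix.mul_assoc]
  rw [exp_conj_diagonal hU, h]
  simp only [trace, diag_apply, diagonal_mul, mul_apply (M := (P * U)ᵀ), transpose_apply]
  exact Finset.sum_nonneg fun k _ => mul_nonneg (Real.exp_pos _).le
    (Finset.sum_nonneg fun l _ => mul_self_nonneg _)

theorem trace_exp_nonneg {A : Matrix n n ℝ} (hA : A.IsHermitian) :
    0 ≤ trace (NormedSpace.exp A) := by
  simpa using trace_mul_exp_nonneg (.one _) hA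

theorem hasDerivAt_trace_exp {A : Matrix n n ℝ} (hA : A.IsHermitian) (θ : ℝ) :
    HasDerivAt (fun θ : ℝ => trace (NormedSpace.exp (-θ • A)))
      (-trace (A * NormedSpace.exp (-θ • A))) θ := by
  obtain ⟨U, a, hU, rfl⟩ := exists_orthogonal_diagonal hA
  simp only [smul_conj_diagonal, exp_conj_diagonal hU, conj_diagonal_mul_conj_diagonal hU,
    trace_conj_diagonal hU, ← Finset.sum_neg_distrib]
  refine HasDerivAt.fun_sum fun k _ =>
    ((hasDerivAt_id θ).neg.mul_const (a k)).exp.congr_deriv ?_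
  simp only [Pi.neg_apply, id]
  ring

theorem le_dotProduct_mulVec_of_trace_exp_le {A : Matrix n n ℝ} (hA : A.IsHermitian) {θ c : ℝ}
    (hθ : 0 < θ) (h : trace (NormedSpace.exp (-θ • A)) ≤ Real.exp (-θ * c)) (v : n → ℝ) :
    c * (v ⬝ᵥ v) ≤ v ⬝ᵥ (A *ᵥ v) := by
  obtain ⟨U, a, hU, rfl⟩ := exists_orthogonal_diagonal hA
  rw [smul_conj_diagonal, exp_conj_diagonal hU, trace_conj_diagonal hU] at h
  have hc (k : n) : c ≤ a k := by
    have hk : Real.exp (-θ * a k) ≤ Real.exp (-θ * c) :=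
      (Finset.single_le_sum (f := fun k => Real.exp (-θ * a k))
        (fun i _ => (Real.exp_pos _).le) (Finset.mem_univ k)).trans h
    have := Real.exp_le_exp.mp hk
    exact le_of_mul_le_mul_left (by linarith) hθ
  have hnorm : v ⬝ᵥ v = (Uᵀ *ᵥ v) ⬝ᵥ (Uᵀ *ᵥ v) := by
    rw [dotProduct_mulVec, vecMul_transpose, mulVec_mulVec, mul_eq_one_comm.mp hU, one_mulVec]
  have hform : v ⬝ᵥ ((U * diagonal a * Uᵀ) *ᵥ v) = (Uᵀ *ᵥ v) ⬝ᵥ (diagonal a *ᵥ (Uᵀ *ᵥ v)) := by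
    rw [← mulVec_mulVec, ← mulVec_mulVec, dotProduct_mulVec, ← mulVec_transpose]
  rw [hnorm, hform]
  simp only [dotProduct, mulVec_diagonal, Finset.mul_sum]
  refine Finset.sum_le_sum fun k _ => ?_
  linarith [mul_le_mul_of_nonneg_right (hc k) (mul_self_nonneg ((Uᵀ *ᵥ v) k))]

end TraceExponential

section Expectation

variable {Ω : Type*} [MeasurableSpace Ω] {μ : Measure Ω}

theorem integrable_comp_of_mem_isCompact [IsFiniteMeasure μ] {E : Type*} [TopologicalSpace E]
    [MeasurableSpace E] [OpensMeasurableSpace E] {K : Set E} (hK : IsCompact K) {h : E → ℝ}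
    (hh : Continuous h) {Z : Ω → E} (hZ : Measurable Z) (hZK : ∀ᵐ ω ∂μ, Z ω ∈ K) :
    Integrable (fun ω => h (Z ω)) μ := by
  obtain ⟨B, hB⟩ := hK.exists_bound_of_continuousOn hh.continuousOn
  refine Integrable.of_bound (C := B) (hh.measurable.comp hZ).aestronglyMeasurable ?_
  filter_upwards [hZK] with ω hω using hB _ hω

theorem hasDerivAt_integral_comp_of_mem_isCompact [IsFiniteMeasure μ] {E : Type*}
    [TopologicalSpace E] [MeasurableSpace E] [OpensMeasurableSpace E] {K : Set E}
    (hK : IsCompact K) {F F' : ℝ → E → ℝ} (hF : ∀ θ, Continuous (F θ))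
    (hF' : Continuous fun z : ℝ × E => F' z.1 z.2) {Z : Ω → E} (hZ : Measurable Z)
    (hZK : ∀ᵐ ω ∂μ, Z ω ∈ K) (hderiv : ∀ z ∈ K, ∀ θ, HasDerivAt (F · z) (F' θ z) θ) (θ : ℝ) :
    HasDerivAt (fun θ => ∫ ω, F θ (Z ω) ∂μ) (∫ ω, F' θ (Z ω) ∂μ) θ := by
  obtain ⟨B, hB⟩ := ((isCompact_Icc (a := θ - 1) (b := θ + 1)).prod hK).exists_bound_of_continuousOn
    hF'.continuousOn
  exact (hasDerivAt_integral_of_dominated_loc_of_deriv_le (bound := fun _ => B)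
    (Icc_mem_nhds (by linarith) (by linarith))
    (.of_forall fun x => ((hF x).measurable.comp hZ).aestronglyMeasurable)
    (integrable_comp_of_mem_isCompact hK (hF θ) hZ hZK)
    ((hF'.comp (.prodMk_right θ)).measurable.comp hZ).aestronglyMeasurable
    (hZK.mono fun ω hω x hx => hB (x, Z ω) ⟨hx, hω⟩) (integrable_const _)
    (hZK.mono fun ω hω x _ => hderiv _ hω x)).2

theorem integral_prod_self_nonpos_of_add_swap_nonpos [SFinite μ] {φ : Ω × Ω → ℝ}
    (hφ : Integrable φ (μ.prod μ)) (h : ∀ᵐ z ∂μ.prod μ, φ z + φ z.swap ≤ 0) :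
    ∫ z, φ z ∂μ.prod μ ≤ 0 := by
  have hsum := integral_nonpos_of_ae h
  have hswap : Integrable (fun z => φ z.swap) (μ.prod μ) := hφ.swap
  rw [integral_add hφ hswap, integral_prod_swap] at hsum
  linarith

theorem integral_comp_nonneg_of_indepFun [IsFiniteMeasure μ] {E E' : Type*} [MeasurableSpace E]
    [MeasurableSpace E'] {X : Ω → E} {Z : Ω → E'} (hX : Measurable X) (hZ : Measurable Z)
    (hXZ : IndepFun X Z μ) {h : E × E' → ℝ} (hh : Measurable h)
    (hint : Integrable (fun ω => h (X ω, Z ω)) μ)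
    (hnonneg : ∀ᵐ ω' ∂μ, 0 ≤ ∫ ω, h (X ω, Z ω') ∂μ) : 0 ≤ ∫ ω, h (X ω, Z ω) ∂μ := by
  have hmap := hXZ.map_prod_eq_prod_map_map hX.aemeasurable hZ.aemeasurable
  have hXZm := (hX.prodMk hZ).aemeasurable (μ := μ)
  have hint' : Integrable h ((μ.map X).prod (μ.map Z)) := by
    rwa [← hmap, integrable_map_measure hh.aestronglyMeasurable hXZm]
  rw [← integral_map hXZm hh.aestronglyMeasurable, hmap, integral_prod_symm _ hint',
    integral_map hZ.aemeasurable hint'.integral_prod_right.aestronglyMeasurable]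
  exact integral_nonneg_of_ae (hnonneg.mono fun ω' hω' => hω'.trans_eq
    (integral_map hX.aemeasurable (hh.comp measurable_prodMk_right).aestronglyMeasurable).symm)

end Expectation

section RandomProjection

local instance matrixMeasurableSpace {n : Type*} : MeasurableSpace (Matrix n n ℝ) :=
  inferInstanceAs (MeasurableSpace (n → n → ℝ))

local instance matrixBorelSpace {n : Type*} [Finite n] : BorelSpace (Matrix n n ℝ) :=
  inferInstanceAs (BorelSpace (n → n → ℝ))

local instance matrixSecondCountableTopology {n : Type*} [Finite n] :
    SecondCountableTopology (Matrix n n ℝ) :=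
  inferInstanceAs (SecondCountableTopology (n → n → ℝ))

variable {n : Type*} [Fintype n]

theorem sum_sq_row_of_isStarProjection {P : Matrix n n ℝ} (hP : IsStarProjection P) (k : n) :
    ∑ l, P k l ^ 2 = P k k := by
  have hsymm (l : n) : P l k = P k l := congrFun₂ hP.isSelfAdjoint.star_eq k l
  conv_rhs => rw [← hP.isIdempotentElem.eq, mul_apply]
  simp only [hsymm, sq]

theorem abs_apply_le_one_of_isStarProjection {P : Matrix n n ℝ} (hP : IsStarProjection P)
    (k l : n) : |P k l| ≤ 1 := by
  have hsq (l : n) : P k l ^ 2 ≤ P k k := by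
    rw [← sum_sq_row_of_isStarProjection hP k]
    exact Finset.single_le_sum (f := fun l => P k l ^ 2) (fun _ _ => sq_nonneg _)
      (Finset.mem_univ l)
  have hdiag : P k k ≤ 1 := by nlinarith [hsq k]
  exact abs_le_of_sq_le_sq (by linarith [hsq l]) zero_le_one

theorem isCompact_setOf_isStarProjection :
    IsCompact {P : Matrix n n ℝ | IsStarProjection P} := by
  have hbox : IsCompact (Set.pi Set.univ fun _ : n => Set.pi Set.univ fun _ : n =>
      Set.Icc (-1 : ℝ) 1) := isCompact_univ_pi fun _ => isCompact_univ_pi fun _ => isCompact_Icc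
  refine hbox.of_isClosed_subset ?_ fun P hP k _ l _ =>
    abs_le.mp (abs_apply_le_one_of_isStarProjection hP k l)
  simp only [isStarProjection_iff, IsIdempotentElem, isSelfAdjoint_iff, Set.ofPred_and]
  exact (isClosed_eq (by fun_prop) (by fun_prop)).inter (isClosed_eq (by fun_prop) (by fun_prop))

variable {Ω : Type*} [MeasurableSpace Ω]

/-- A random orthogonal projection whose expectation is the scalar matrix `p`; for the projection
onto a random subspace of dimension `r` of `ℝ ^ d`, `p = r / d`. -/
structure IsIsotropicProjection [DecidableEq n] (μ : Measure Ω) (p : ℝ) (P : Ω → Matrix n n ℝ) :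
    Prop where
  measurable : Measurable P
  isStarProjection : ∀ᵐ ω ∂μ, IsStarProjection (P ω)
  mean : ∀ k l, ∫ ω, P ω k l ∂μ = (p • (1 : Matrix n n ℝ)) k l

variable [DecidableEq n] {μ : Measure Ω} {p : ℝ} {P : Ω → Matrix n n ℝ}

namespace IsIsotropicProjection

theorem integrable_comp [IsFiniteMeasure μ] (hP : IsIsotropicProjection μ p P)
    {h : Matrix n n ℝ → ℝ} (hh : Continuous h) : Integrable (fun ω => h (P ω)) μ :=
  integrable_comp_of_mem_isCompact isCompact_setOf_isStarProjection hh hP.measurable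
    hP.isStarProjection

theorem integral_trace_mul [IsFiniteMeasure μ] (hP : IsIsotropicProjection μ p P)
    (A : Matrix n n ℝ) : ∫ ω, trace (P ω * A) ∂μ = p * trace A := by
  have hint (k l : n) : Integrable (fun ω => P ω k l * A l k) μ :=
    hP.integrable_comp (h := fun B => B k l * A l k) (by fun_prop)
  simp only [trace, diag_apply, mul_apply]
  rw [integral_finsetSum _ fun k _ => integrable_finsetSum _ fun l _ => hint k l]
  simp only [integral_finsetSum _ fun l _ => hint _ l, integral_mul_const, hP.mean,
    Finset.mul_sum]
  simp [Matrix.smul_apply, Matrix.one_apply]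

end IsIsotropicProjection

end RandomProjection

section Decoupling

attribute [local instance] matrixMeasurableSpace matrixBorelSpace matrixSecondCountableTopology

variable {n : Type*} [Fintype n] [DecidableEq n]

/-- The function of two projections `A` and `B` that compares the exponential of `Y - t A` with an
exchange of `A` for `B`; its expectation at an independent copy is nonpositive. -/
noncomputable def exchangeGap (Y : Matrix n n ℝ) (t : ℝ) (A B : Matrix n n ℝ) : ℝ :=
  trace ((B - A) * NormedSpace.exp (Y - t • A)) -
    t / 2 * trace ((B - A) * (B - A) * NormedSpace.exp (Y - t • A))

theorem continuous_exchangeGap (Y : Matrix n n ℝ) (t : ℝ) :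
    Continuous fun z : Matrix n n ℝ × Matrix n n ℝ => exchangeGap Y t z.1 z.2 := by
  unfold exchangeGap
  fun_prop

theorem exchangeGap_add_swap_nonpos {Y A B : Matrix n n ℝ} (hY : Y.IsHermitian)
    (hA : A.IsHermitian) (hB : B.IsHermitian) {t : ℝ} (ht : 0 < t) :
    exchangeGap Y t A B + exchangeGap Y t B A ≤ 0 := by
  have key := trace_sub_mul_exp_sub_exp_le (hY.sub (hA.smul (.all t))) (hY.sub (hB.smul (.all t)))
  have hdiff : Y - t • A - (Y - t • B) = t • (B - A) := by rw [smul_sub]; abel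
  have hsq : (A - B) * (A - B) = (B - A) * (B - A) := by rw [← neg_sub B A, neg_mul_neg]
  rw [hdiff, smul_mul_assoc, smul_mul_smul_comm, smul_mul_assoc, trace_smul, trace_smul,
    Matrix.mul_sub, Matrix.mul_add, trace_sub, trace_add, smul_eq_mul, smul_eq_mul] at key
  rw [exchangeGap, exchangeGap, hsq, ← neg_sub B A, Matrix.neg_mul, trace_neg]
  refine le_of_mul_le_mul_left ?_ ht
  linarith

theorem exchangeGap_eq_of_isStarProjection (Y : Matrix n n ℝ) (t : ℝ) {A B : Matrix n n ℝ}
    (hA : IsStarProjection A) (hB : IsStarProjection B) {G : Matrix n n ℝ}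
    (hG : G = NormedSpace.exp (Y - t • A)) :
    exchangeGap Y t A B = trace (B * ((1 - t / 2) • G + (t / 2) • (G * A + A * G))) -
      (1 + t / 2) * trace (A * G) := by
  have hcycle : trace (A * B * G) = trace (B * (G * A)) := by
    rw [Matrix.mul_assoc, trace_mul_comm, Matrix.mul_assoc]
  simp only [exchangeGap, ← hG, Matrix.sub_mul, Matrix.mul_sub, hA.isIdempotentElem.eq,
    hB.isIdempotentElem.eq, trace_sub, Matrix.mul_add, Matrix.mul_smul, trace_add, trace_smul,
    smul_eq_mul, hcycle, Matrix.mul_assoc B A]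
  ring

variable {Ω : Type*} [MeasurableSpace Ω] {μ : Measure Ω} [IsProbabilityMeasure μ] {p : ℝ}
  {P : Ω → Matrix n n ℝ}

namespace IsIsotropicProjection

theorem integrable_comp_prod (hP : IsIsotropicProjection μ p P)
    {h : Matrix n n ℝ × Matrix n n ℝ → ℝ} (hh : Continuous h) :
    Integrable (fun z : Ω × Ω => h (P z.1, P z.2)) (μ.prod μ) := by
  refine integrable_comp_of_mem_isCompact
    (isCompact_setOf_isStarProjection.prod isCompact_setOf_isStarProjection) hh
    ((hP.measurable.comp measurable_fst).prodMk (hP.measurable.comp measurable_snd)) ?_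
  filter_upwards [Measure.quasiMeasurePreserving_fst.ae hP.isStarProjection,
    Measure.quasiMeasurePreserving_snd.ae hP.isStarProjection] with z h₁ h₂ using ⟨h₁, h₂⟩

theorem integral_exchangeGap (hP : IsIsotropicProjection μ p P) (Y : Matrix n n ℝ) (t : ℝ)
    {A : Matrix n n ℝ} (hA : IsStarProjection A) :
    ∫ ω, exchangeGap Y t A (P ω) ∂μ =
      (1 - t / 2) * p * trace (NormedSpace.exp (Y - t • A)) -
        (1 + t / 2 - t * p) * trace (A * NormedSpace.exp (Y - t • A)) := by
  set G := NormedSpace.exp (Y - t • A) with hG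
  set C := (1 - t / 2) • G + (t / 2) • (G * A + A * G)
  calc ∫ ω, exchangeGap Y t A (P ω) ∂μ
      = ∫ ω, (trace (P ω * C) - (1 + t / 2) * trace (A * G)) ∂μ :=
        integral_congr_ae (hP.isStarProjection.mono fun ω hω =>
          exchangeGap_eq_of_isStarProjection Y t hA hω hG)
    _ = p * trace C - (1 + t / 2) * trace (A * G) := by
        rw [integral_sub (hP.integrable_comp (h := fun B => trace (B * C)) (by fun_prop))
          (integrable_const _), hP.integral_trace_mul, integral_const, probReal_univ, one_smul]
    _ = _ := by
        simp only [C, trace_add, trace_smul, smul_eq_mul, trace_mul_comm G A]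
        ring

theorem mul_integral_trace_exp_le (hP : IsIsotropicProjection μ p P) (hp : 0 ≤ p)
    {Y : Matrix n n ℝ} (hY : Y.IsHermitian) {t : ℝ} (ht : 0 ≤ t) :
    (1 - t / 2) * p * ∫ ω, trace (NormedSpace.exp (Y - t • P ω)) ∂μ ≤
      (1 + t / 2) * ∫ ω, trace (P ω * NormedSpace.exp (Y - t • P ω)) ∂μ := by
  rcases ht.eq_or_lt with rfl | ht
  · simp [hP.integral_trace_mul]
  have hgap : ∫ z, exchangeGap Y t (P z.1) (P z.2) ∂μ.prod μ ≤ 0 := by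
    refine integral_prod_self_nonpos_of_add_swap_nonpos
      (hP.integrable_comp_prod (continuous_exchangeGap Y t)) ?_
    filter_upwards [Measure.quasiMeasurePreserving_fst.ae hP.isStarProjection,
      Measure.quasiMeasurePreserving_snd.ae hP.isStarProjection] with z h₁ h₂
    exact exchangeGap_add_swap_nonpos hY h₁.isSelfAdjoint h₂.isSelfAdjoint ht
  have hG : Integrable (fun ω => trace (NormedSpace.exp (Y - t • P ω))) μ :=
    hP.integrable_comp (h := fun A => trace (NormedSpace.exp (Y - t • A))) (by fun_prop)
  have hPG : Integrable (fun ω => trace (P ω * NormedSpace.exp (Y - t • P ω))) μ :=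
    hP.integrable_comp (h := fun A => trace (A * NormedSpace.exp (Y - t • A))) (by fun_prop)
  have hPG_nonneg : 0 ≤ ∫ ω, trace (P ω * NormedSpace.exp (Y - t • P ω)) ∂μ :=
    integral_nonneg_of_ae (hP.isStarProjection.mono fun ω hω =>
      trace_mul_exp_nonneg hω (hY.sub (IsHermitian.smul hω.isSelfAdjoint (.all t))))
  rw [integral_prod _ (hP.integrable_comp_prod (continuous_exchangeGap Y t)),
    integral_congr_ae (hP.isStarProjection.mono fun ω hω => hP.integral_exchangeGap Y t hω),
    integral_sub (hG.const_mul _) (hPG.const_mul _), integral_const_mul, integral_const_mul]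
    at hgap
  linarith [mul_nonneg (mul_nonneg ht.le hp) hPG_nonneg]

end IsIsotropicProjection

end Decoupling

section MatrixChernoff

theorem le_mul_exp_of_hasDerivAt_le {f f' : ℝ → ℝ} {k a : ℝ} (ha : 0 ≤ a)
    (hf : ∀ x, HasDerivAt f (f' x) x) (hf' : ∀ x ∈ Set.Icc 0 a, f' x ≤ -k * f x) :
    f a ≤ f 0 * Real.exp (-k * a) := by
  have hderiv (x : ℝ) : HasDerivAt (fun x => f x * Real.exp (k * x))
      ((f' x + k * f x) * Real.exp (k * x)) x := by
    refine ((hf x).mul ((hasDerivAt_id x).const_mul k).exp).congr_deriv ?_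
    simp only [id]
    ring
  have hanti : AntitoneOn (fun x => f x * Real.exp (k * x)) (Set.Icc 0 a) := by
    refine antitoneOn_of_hasDerivWithinAt_nonpos (convex_Icc _ _)
      (fun x _ => (hderiv x).continuousAt.continuousWithinAt)
      (fun x _ => (hderiv x).hasDerivWithinAt) fun x hx => ?_
    exact mul_nonpos_of_nonpos_of_nonneg (by linarith [hf' x (interior_subset hx)])
      (Real.exp_pos _).le
  have h := hanti (Set.left_mem_Icc.mpr ha) (Set.right_mem_Icc.mpr ha) ha
  simp only [mul_zero, Real.exp_zero, mul_one] at h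
  rwa [neg_mul, Real.exp_neg, ← div_eq_mul_inv, le_div_iff₀ (Real.exp_pos _)]

theorem indepFun_sum_smul_of_notMem {Ω ι E : Type*} [MeasurableSpace Ω] {μ : Measure Ω}
    [AddCommGroup E] [Module ℝ E] [MeasurableSpace E] [MeasurableAdd₂ E] [MeasurableConstSMul ℝ E]
    {f : ι → Ω → E} (hind : iIndepFun f μ) (hf : ∀ i, Measurable (f i)) {s : Finset ι} {i : ι}
    (hi : i ∉ s) (c : ι → ℝ) : IndepFun (f i) (fun ω => ∑ j ∈ s, c j • f j ω) μ := by
  have heval : Measurable fun v : ({i} : Finset ι) → E => v ⟨i, Finset.mem_singleton_self i⟩ :=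
    measurable_pi_apply _
  have hsum : Measurable fun v : s → E => ∑ j : s, c j • v j :=
    Finset.measurable_fun_sum _ fun j _ => (measurable_pi_apply j).const_smul (c j)
  have h := (hind.indepFun_finset {i} s (Finset.disjoint_singleton_left.mpr hi) hf).comp heval hsum
  simp only [← Finset.sum_coe_sort s fun j => c j • f j _]
  exact h

attribute [local instance] matrixMeasurableSpace matrixBorelSpace matrixSecondCountableTopology

variable {n : Type*}

theorem isHermitian_sum_smul {ι : Type*} (s : Finset ι) (c : ι → ℝ) {P : ι → Matrix n n ℝ}
    (hP : ∀ i, (P i).IsHermitian) : (∑ i ∈ s, c i • P i).IsHermitian :=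
  isSelfAdjoint_sum s fun i _ => IsHermitian.smul (hP i) (.all (c i))

variable [Fintype n] [DecidableEq n] {ι Ω : Type*} [MeasurableSpace Ω] {μ : Measure Ω}
  {p c : ι → ℝ} {P : ι → Ω → Matrix n n ℝ}

theorem ae_forall_isStarProjection [Countable ι]
    (hP : ∀ i, IsIsotropicProjection μ (p i) (P i)) :
    ∀ᵐ ω ∂μ, (fun i => P i ω) ∈ Set.pi Set.univ fun _ => {A | IsStarProjection A} :=
  (ae_all_iff.mpr fun i => (hP i).isStarProjection).mono fun _ h i _ => h i

theorem integrable_comp_family [Countable ι] [IsFiniteMeasure μ]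
    (hP : ∀ i, IsIsotropicProjection μ (p i) (P i))
    {h : (ι → Matrix n n ℝ) → ℝ} (hh : Continuous h) :
    Integrable (fun ω => h fun i => P i ω) μ :=
  integrable_comp_of_mem_isCompact (isCompact_univ_pi fun _ => isCompact_setOf_isStarProjection)
    hh (measurable_pi_lambda _ fun i => (hP i).measurable) (ae_forall_isStarProjection hP)

variable [Fintype ι]

theorem integral_trace_exp_sum_nonneg (hP : ∀ i, IsIsotropicProjection μ (p i) (P i)) (θ : ℝ) :
    0 ≤ ∫ ω, trace (NormedSpace.exp (-θ • ∑ j, c j • P j ω)) ∂μ :=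
  integral_nonneg_of_ae ((ae_forall_isStarProjection hP).mono fun _ hω => trace_exp_nonneg
    ((isHermitian_sum_smul _ c fun i => (hω i trivial).isSelfAdjoint).smul (.all (-θ))))

variable [IsProbabilityMeasure μ]

theorem integrable_trace_mul_exp_sum (hP : ∀ i, IsIsotropicProjection μ (p i) (P i)) (θ : ℝ)
    (i : ι) : Integrable
      (fun ω => trace (P i ω * NormedSpace.exp (-θ • ∑ j, c j • P j ω))) μ :=
  integrable_comp_family hP
    (h := fun A => trace (A i * NormedSpace.exp (-θ • ∑ j, c j • A j))) (by fun_prop)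

theorem mul_integral_trace_exp_sum_le (hP : ∀ i, IsIsotropicProjection μ (p i) (P i))
    (hind : iIndepFun P μ) {i : ι} (hp : 0 ≤ p i) {θ : ℝ} (hθ : 0 ≤ θ * c i) :
    (1 - θ * c i / 2) * p i * ∫ ω, trace (NormedSpace.exp (-θ • ∑ j, c j • P j ω)) ∂μ ≤
      (1 + θ * c i / 2) *
        ∫ ω, trace (P i ω * NormedSpace.exp (-θ • ∑ j, c j • P j ω)) ∂μ := by
  classical
  set Z : Ω → Matrix n n ℝ := fun ω => ∑ j ∈ Finset.univ.erase i, c j • P j ω with hZ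
  have hZm : Measurable Z :=
    Finset.measurable_fun_sum _ fun j _ => (hP j).measurable.const_smul (c j)
  have hsum (ω : Ω) : -θ • ∑ j, c j • P j ω = -θ • Z ω - (θ * c i) • P i ω := by
    rw [hZ, ← Finset.add_sum_erase _ _ (Finset.mem_univ i), smul_add, smul_smul, neg_mul, neg_smul]
    abel
  have hint := integrable_trace_mul_exp_sum (c := c) hP θ i
  have hint₀ : Integrable (fun ω => trace (NormedSpace.exp (-θ • ∑ j, c j • P j ω))) μ :=
    integrable_comp_family hP (h := fun A => trace (NormedSpace.exp (-θ • ∑ j, c j • A j)))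
      (by fun_prop)
  simp only [hsum] at hint hint₀ ⊢
  rw [← sub_nonneg, ← integral_const_mul, ← integral_const_mul,
    ← integral_sub (hint.const_mul _) (hint₀.const_mul _)]
  refine integral_comp_nonneg_of_indepFun (hP i).measurable hZm
    (indepFun_sum_smul_of_notMem hind (fun j => (hP j).measurable) (Finset.notMem_erase i _) c)
    (h := fun z => (1 + θ * c i / 2) *
      trace (z.1 * NormedSpace.exp (-θ • z.2 - (θ * c i) • z.1)) -
      (1 - θ * c i / 2) * p i * trace (NormedSpace.exp (-θ • z.2 - (θ * c i) • z.1)))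
    (Continuous.measurable (by fun_prop)) ((hint.const_mul _).sub (hint₀.const_mul _)) ?_
  filter_upwards [ae_forall_isStarProjection hP] with ω' hω'
  rw [integral_sub, integral_const_mul, integral_const_mul, sub_nonneg]
  · exact (hP i).mul_integral_trace_exp_le hp
      ((isHermitian_sum_smul _ c fun j => (hω' j trivial).isSelfAdjoint).smul (.all (-θ))) hθ
  · exact (hP i).integrable_comp (h := fun A => (1 + θ * c i / 2) *
      trace (A * NormedSpace.exp (-θ • Z ω' - (θ * c i) • A))) (by fun_prop)
  · exact (hP i).integrable_comp (h := fun A => (1 - θ * c i / 2) * p i *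
      trace (NormedSpace.exp (-θ • Z ω' - (θ * c i) • A))) (by fun_prop)

theorem integral_trace_sum_mul_exp_sum (hP : ∀ i, IsIsotropicProjection μ (p i) (P i)) (θ : ℝ) :
    ∫ ω, trace ((∑ j, c j • P j ω) * NormedSpace.exp (-θ • ∑ j, c j • P j ω)) ∂μ =
      ∑ i, c i * ∫ ω, trace (P i ω * NormedSpace.exp (-θ • ∑ j, c j • P j ω)) ∂μ := by
  simp only [Finset.sum_mul, trace_sum, smul_mul_assoc, trace_smul, smul_eq_mul]
  rw [integral_finsetSum _ fun i _ => (integrable_trace_mul_exp_sum hP θ i).const_mul (c i)]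
  simp only [integral_const_mul]

theorem hasDerivAt_integral_trace_exp_sum (hP : ∀ i, IsIsotropicProjection μ (p i) (P i))
    (θ : ℝ) : HasDerivAt (fun θ : ℝ => ∫ ω, trace (NormedSpace.exp (-θ • ∑ j, c j • P j ω)) ∂μ)
      (-∫ ω, trace ((∑ j, c j • P j ω) * NormedSpace.exp (-θ • ∑ j, c j • P j ω)) ∂μ) θ := by
  rw [← integral_neg]
  exact hasDerivAt_integral_comp_of_mem_isCompact
    (isCompact_univ_pi fun _ => isCompact_setOf_isStarProjection)
    (F := fun θ A => trace (NormedSpace.exp (-θ • ∑ j, c j • A j)))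
    (F' := fun θ A => -trace ((∑ j, c j • A j) * NormedSpace.exp (-θ • ∑ j, c j • A j)))
    (fun θ => by fun_prop) (by fun_prop) (measurable_pi_lambda _ fun i => (hP i).measurable)
    (ae_forall_isStarProjection hP)
    (fun A hA => hasDerivAt_trace_exp
      (isHermitian_sum_smul _ c fun i => (hA i trivial).isSelfAdjoint)) θ

theorem three_fifths_mul_integral_trace_exp_sum_le
    (hP : ∀ i, IsIsotropicProjection μ (p i) (P i)) (hind : iIndepFun P μ) (hp : ∀ i, 0 ≤ p i)
    (hc : ∀ i, 0 ≤ c i) (hsum : ∑ i, c i * p i = 1) {θ : ℝ} (hθ : 0 ≤ θ)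
    (hθc : ∀ i, θ * c i ≤ 1 / 2) :
    3 / 5 * ∫ ω, trace (NormedSpace.exp (-θ • ∑ j, c j • P j ω)) ∂μ ≤
      ∫ ω, trace ((∑ j, c j • P j ω) * NormedSpace.exp (-θ • ∑ j, c j • P j ω)) ∂μ := by
  rw [integral_trace_sum_mul_exp_sum hP, ← one_mul (∫ _, _ ∂μ), ← hsum, Finset.sum_mul,
    Finset.mul_sum]
  refine Finset.sum_le_sum fun i _ => ?_
  have hm := integral_trace_exp_sum_nonneg (c := c) hP θ
  have h := mul_integral_trace_exp_sum_le hP hind (hp i) (mul_nonneg hθ (hc i))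
  set m := ∫ ω, trace (NormedSpace.exp (-θ • ∑ j, c j • P j ω)) ∂μ
  set D := ∫ ω, trace (P i ω * NormedSpace.exp (-θ • ∑ j, c j • P j ω)) ∂μ
  have hD : 3 / 5 * (p i * m) ≤ D := by
    refine le_of_mul_le_mul_left ?_ (by linarith [mul_nonneg hθ (hc i)] : 0 < 1 + θ * c i / 2)
    have := mul_nonneg (sub_nonneg.mpr (hθc i)) (mul_nonneg (hp i) hm)
    linarith
  linarith [mul_le_mul_of_nonneg_left hD (hc i)]

theorem integral_trace_exp_sum_le (hP : ∀ i, IsIsotropicProjection μ (p i) (P i))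
    (hind : iIndepFun P μ) (hp : ∀ i, 0 ≤ p i) (hc : ∀ i, 0 ≤ c i) (hsum : ∑ i, c i * p i = 1)
    {θ : ℝ} (hθ : 0 ≤ θ) (hθc : ∀ i, θ * c i ≤ 1 / 2) :
    ∫ ω, trace (NormedSpace.exp (-θ • ∑ j, c j • P j ω)) ∂μ ≤
      Fintype.card n * Real.exp (-(3 / 5) * θ) := by
  have h := le_mul_exp_of_hasDerivAt_le (k := 3 / 5) hθ
    (fun x => hasDerivAt_integral_trace_exp_sum (c := c) hP x) fun x hx => ?_
  · simpa using h
  · have := three_fifths_mul_integral_trace_exp_sum_le hP hind hp hc hsum hx.1 fun i =>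
      (mul_le_mul_of_nonneg_right hx.2 (hc i)).trans (hθc i)
    linarith

theorem exists_half_le_sum_projections (hP : ∀ i, IsIsotropicProjection μ (p i) (P i))
    (hind : iIndepFun P μ) (hp : ∀ i, 0 ≤ p i) (hc : ∀ i, 0 ≤ c i) (hsum : ∑ i, c i * p i = 1)
    {R : ℝ} (hR : 0 < R) (hcR : ∀ i, c i ≤ R) :
    ∃ E : Set Ω, MeasurableSet E ∧
      1 - Fintype.card n * Real.exp (-(1 / (20 * R))) ≤ μ.real E ∧
      ∀ᵐ ω ∂μ, ω ∈ E → ∀ v : n → ℝ,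
        1 / 2 * (v ⬝ᵥ v) ≤ ∑ i, c i * (v ⬝ᵥ (P i ω *ᵥ v)) := by
  set θ := 1 / (2 * R) with hθ
  have hθ0 : 0 < θ := by positivity
  have hcont : Continuous fun A : ι → Matrix n n ℝ =>
    trace (NormedSpace.exp (-θ • ∑ j, c j • A j)) := by fun_prop
  set g : Ω → ℝ := fun ω => trace (NormedSpace.exp (-θ • ∑ j, c j • P j ω))
  have hgm : Measurable g :=
    hcont.measurable.comp (measurable_pi_lambda _ fun i => (hP i).measurable)
  have hherm : ∀ᵐ ω ∂μ, (∑ j, c j • P j ω).IsHermitian :=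
    (ae_forall_isStarProjection hP).mono fun _ hω =>
      isHermitian_sum_smul _ c fun i => (hω i trivial).isSelfAdjoint
  have hE : MeasurableSet {ω | Real.exp (-θ * (1 / 2)) ≤ g ω} :=
    measurableSet_le measurable_const hgm
  refine ⟨{ω | Real.exp (-θ * (1 / 2)) ≤ g ω}ᶜ, hE.compl, ?_, ?_⟩
  · have hmarkov := mul_meas_ge_le_integral_of_nonneg
      (hherm.mono fun ω hω => trace_exp_nonneg (hω.smul (.all (-θ))))
      (integrable_comp_family hP hcont) (Real.exp (-θ * (1 / 2)))
    have hmean := integral_trace_exp_sum_le hP hind hp hc hsum hθ0.le fun i => by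
      rw [hθ, one_div_mul_eq_div, div_le_div_iff₀ (by positivity) two_pos]
      linarith [hcR i]
    have hsplit : Real.exp (-(3 / 5) * θ) =
        Real.exp (-θ * (1 / 2)) * Real.exp (-(1 / (20 * R))) := by
      rw [← Real.exp_add, hθ]
      congr 1
      field_simp
      norm_num
    rw [hsplit, mul_left_comm] at hmean
    rw [probReal_compl_eq_one_sub hE]
    linarith [le_of_mul_le_mul_left (hmarkov.trans hmean) (Real.exp_pos _)]
  · filter_upwards [hherm] with ω hω hmem v
    have h := le_dotProduct_mulVec_of_trace_exp_le hω hθ0 (not_le.mp fun h => hmem h).le v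
    simpa only [sum_mulVec, dotProduct_sum, smul_mulVec, dotProduct_smul, smul_eq_mul] using h

end MatrixChernoff

section Operators

variable {H : Type*} [NormedAddCommGroup H] [InnerProductSpace ℝ H]

theorem inner_apply_self_le_of_le {S T : Module.End ℝ H} (h : S ≤ T) (f : H) :
    ⟪S f, f⟫_ℝ ≤ ⟪T f, f⟫_ℝ := by
  simpa only [LinearMap.sub_apply, inner_sub_left, sub_nonneg] using
    ((LinearMap.le_def S T).mp h).inner_nonneg_left f

theorem le_of_inner_apply_self_le {S T : Module.End ℝ H} (hS : S.IsSymmetric)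
    (hT : T.IsSymmetric) (h : ∀ f, ⟪S f, f⟫_ℝ ≤ ⟪T f, f⟫_ℝ) : S ≤ T :=
  (LinearMap.le_def S T).mpr ⟨hT.sub hS, fun f => by
    simpa only [LinearMap.sub_apply, inner_sub_left, RCLike.re_to_real, sub_nonneg] using h f⟩

theorem isSymmetric_smul_one (c : ℝ) : (c • (1 : Module.End ℝ H)).IsSymmetric :=
  LinearMap.IsSymmetric.id.smul (conj_trivial c)

theorem isSymmetric_of_nonneg {D : Module.End ℝ H} (hD : 0 ≤ D) : D.IsSymmetric :=
  ((LinearMap.nonneg_iff_isPositive D).mp hD).isSymmetric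

theorem smul_le_smul_of_le {S T : Module.End ℝ H} {c : ℝ} (hc : 0 ≤ c) (h : S ≤ T) :
    c • S ≤ c • T := by
  rw [LinearMap.le_def, ← smul_sub]
  exact ((LinearMap.le_def S T).mp h).smul_of_nonneg hc

theorem smul_one_le_smul_one {c c' : ℝ} (h : c ≤ c') :
    c • (1 : Module.End ℝ H) ≤ c' • (1 : Module.End ℝ H) := by
  rw [LinearMap.le_def, ← sub_smul]
  exact LinearMap.isPositive_one.smul_of_nonneg (sub_nonneg.mpr h)

theorem inner_smul_one_apply_self (c : ℝ) (f : H) :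
    ⟪(c • (1 : Module.End ℝ H)) f, f⟫_ℝ = c * ‖f‖ ^ 2 := by
  rw [LinearMap.smul_apply, Module.End.one_apply, real_inner_smul_left, real_inner_self_eq_norm_sq]

theorem le_of_smul_one_le_smul_one [Nontrivial H] {c c' : ℝ}
    (h : c • (1 : Module.End ℝ H) ≤ c' • (1 : Module.End ℝ H)) : c ≤ c' := by
  obtain ⟨f, hf⟩ := exists_ne (0 : H)
  have hle := inner_apply_self_le_of_le h f
  rw [inner_smul_one_apply_self, inner_smul_one_apply_self] at hle
  exact le_of_mul_le_mul_right hle (pow_pos (norm_pos_iff.mpr hf) 2)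

theorem isUnit_of_smul_one_le [FiniteDimensional ℝ H] {D : Module.End ℝ H} {c : ℝ} (hc : 0 < c)
    (hD : c • (1 : Module.End ℝ H) ≤ D) : IsUnit D := by
  rw [LinearMap.isUnit_iff_ker_eq_bot, LinearMap.ker_eq_bot']
  intro f hf
  have h := inner_apply_self_le_of_le hD f
  rw [inner_smul_one_apply_self, hf, inner_zero_left] at h
  exact norm_eq_zero.mp (pow_eq_zero_iff two_ne_zero |>.mp
    (le_antisymm (nonpos_of_mul_nonpos_right h hc) (sq_nonneg _)))

theorem le_smul_one_of_norm_apply_sq_le {D : Module.End ℝ H} (hD : 0 ≤ D) {c : ℝ}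
    (hc : 0 ≤ c) (h : ∀ f, ‖D f‖ ^ 2 ≤ c * ⟪D f, f⟫_ℝ) : D ≤ c • (1 : Module.End ℝ H) := by
  have hpos : D.IsPositive := (LinearMap.nonneg_iff_isPositive D).mp hD
  refine le_of_inner_apply_self_le hpos.isSymmetric (isSymmetric_smul_one c) fun f => ?_
  rw [inner_smul_one_apply_self]
  rcases (hpos.inner_nonneg_left f).eq_or_lt with hzero | hlt
  · rw [← hzero]
    positivity
  · refine le_of_mul_le_mul_left ?_ hlt
    calc ⟪D f, f⟫_ℝ * ⟪D f, f⟫_ℝ ≤ ‖D f‖ ^ 2 * ‖f‖ ^ 2 := by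
          rw [← mul_pow, ← pow_two]
          exact pow_le_pow_left₀ hlt.le (real_inner_le_norm _ _) 2
      _ ≤ c * ⟪D f, f⟫_ℝ * ‖f‖ ^ 2 := by gcongr; exact h f
      _ = ⟪D f, f⟫_ℝ * (c * ‖f‖ ^ 2) := by ring

theorem sum_inner_le_sum_inner_of_sum_apply_eq {ι : Type*} {s : Finset ι}
    {B : ι → Module.End ℝ H} (hB : ∀ i, 0 ≤ B i) {h : H} {g : ι → H}
    (hg : ∑ i ∈ s, B i h = ∑ i ∈ s, B i (g i)) :
    ∑ i ∈ s, ⟪B i h, h⟫_ℝ ≤ ∑ i ∈ s, ⟪B i (g i), g i⟫_ℝ := by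
  have hpos (i : ι) : (B i).IsPositive := (LinearMap.nonneg_iff_isPositive _).mp (hB i)
  have hexp (i : ι) : ⟪B i (g i - h), g i - h⟫_ℝ =
      ⟪B i (g i), g i⟫_ℝ - 2 * ⟪B i (g i), h⟫_ℝ + ⟪B i h, h⟫_ℝ := by
    have := (hpos i).isSymmetric h (g i)
    rw [map_sub, inner_sub_left, inner_sub_right, inner_sub_right, this, real_inner_comm _ h]
    ring
  have hcross : ∑ i ∈ s, ⟪B i (g i), h⟫_ℝ = ∑ i ∈ s, ⟪B i h, h⟫_ℝ := by
    rw [← sum_inner, ← sum_inner, hg]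
  have hnonneg := Finset.sum_nonneg fun i (_ : i ∈ s) => (hpos i).inner_nonneg_left (g i - h)
  simp only [hexp, Finset.sum_add_distrib, Finset.sum_sub_distrib, ← Finset.mul_sum,
    hcross] at hnonneg
  linarith

theorem pow_apply_of_eigen {D : Module.End ℝ H} {a : ℝ} {f : H} (h : D f = a • f) (t : ℕ) :
    (D ^ t) f = a ^ t • f := by
  induction t with
  | zero => simp
  | succ t ih => rw [pow_succ', Module.End.mul_apply, ih, map_smul, h, smul_smul, pow_succ]

theorem exists_eigenbasis [FiniteDimensional ℝ H] {D : Module.End ℝ H} (hD : D.IsSymmetric) :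
    ∃ (e : OrthonormalBasis (Fin (Module.finrank ℝ H)) ℝ H)
      (l : Fin (Module.finrank ℝ H) → ℝ), ∀ k, D (e k) = l k • e k :=
  ⟨hD.eigenvectorBasis rfl, hD.eigenvalues rfl, fun k => by simp⟩

theorem eigenvalue_le_of_le {S T : Module.End ℝ H} (h : S ≤ T) {f : H} (hf : ‖f‖ = 1) {a b : ℝ}
    (hS : S f = a • f) (hT : T f = b • f) : a ≤ b := by
  simpa [hS, hT, real_inner_smul_left, hf] using inner_apply_self_le_of_le h f

section Diagonal

variable {ι : Type*} [Fintype ι] (e : OrthonormalBasis ι ℝ H) {D D' : Module.End ℝ H}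
  {a a' : ι → ℝ}

theorem inner_apply_of_diagonal (hD : ∀ k, D (e k) = a k • e k) (f g : H) :
    ⟪D f, g⟫_ℝ = ∑ k, a k * (⟪e k, f⟫_ℝ * ⟪e k, g⟫_ℝ) := by
  conv_lhs => rw [← e.sum_repr' f]
  simp only [map_sum, map_smul, hD, sum_inner, real_inner_smul_left]
  exact Finset.sum_congr rfl fun k _ => by ring

theorem isSymmetric_of_diagonal (hD : ∀ k, D (e k) = a k • e k) : D.IsSymmetric := fun f g => by
  rw [inner_apply_of_diagonal e hD, real_inner_comm, inner_apply_of_diagonal e hD]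
  simp only [mul_comm ⟪e _, f⟫_ℝ]

theorem inner_basis_apply_of_diagonal (hD : ∀ k, D (e k) = a k • e k) (k : ι) (f : H) :
    ⟪e k, D f⟫_ℝ = a k * ⟪e k, f⟫_ℝ := by
  rw [← isSymmetric_of_diagonal e hD, hD, real_inner_smul_left]

theorem le_of_diagonal (hD : ∀ k, D (e k) = a k • e k) (hD' : ∀ k, D' (e k) = a' k • e k)
    (h : ∀ k, a k ≤ a' k) : D ≤ D' := by
  have hsub (k : ι) : (D' - D) (e k) = (a' k - a k) • e k := by
    rw [LinearMap.sub_apply, hD, hD', sub_smul]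
  refine (LinearMap.le_def D D').mpr ⟨isSymmetric_of_diagonal e hsub, fun f => ?_⟩
  rw [RCLike.re_to_real, inner_apply_of_diagonal e hsub]
  exact Finset.sum_nonneg fun k _ => mul_nonneg (sub_nonneg.mpr (h k)) (mul_self_nonneg _)

theorem commute_of_diagonal (hD : ∀ k, D (e k) = a k • e k) (hD' : ∀ k, D' (e k) = a' k • e k) :
    Commute D D' :=
  e.toBasis.ext fun k => by
    simp only [e.coe_toBasis, Module.End.mul_apply, hD, hD', map_smul, smul_comm (a k)]

end Diagonal

/-- `A` is a spectral filter for the positive operator `T`, as applied by a client in one round: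
after `s` local steps of size `η` the client's model moves by `η T A` towards its data, where
`s / κ ≤ A ≤ s` on the range of `T` and `η T A ≤ 1`. -/
structure IsLocalFilter (η s κ : ℝ) (T A : Module.End ℝ H) : Prop where
  commute : Commute A T
  isSymmetric : A.IsSymmetric
  mul_le : T * A ≤ s • T
  le_mul : (s / κ) • T ≤ T * A
  smul_mul_le_one : η • (T * A) ≤ 1
  mul_mul_le : A * T * A ≤ s • (T * A)

theorem isLocalFilter_of_eigenbasis {ι : Type*} [Fintype ι] (e : OrthonormalBasis ι ℝ H)
    {η s κ : ℝ} {T A : Module.End ℝ H} {l a : ι → ℝ} (hT : ∀ k, T (e k) = l k • e k)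
    (hA : ∀ k, A (e k) = a k • e k) (hl : ∀ k, 0 ≤ l k) (ha : ∀ k, 0 ≤ a k)
    (has : ∀ k, a k ≤ s) (hκ : ∀ k, s / κ ≤ a k) (hone : ∀ k, η * l k * a k ≤ 1) :
    IsLocalFilter η s κ T A := by
  have hTA (k : ι) : (T * A) (e k) = (l k * a k) • e k := by
    rw [Module.End.mul_apply, hA, map_smul, hT, smul_smul, mul_comm]
  have hATA (k : ι) : (A * T * A) (e k) = (a k * (l k * a k)) • e k := by
    rw [mul_assoc, Module.End.mul_apply, hTA, map_smul, hA, smul_smul, mul_comm]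
  have hsmul {D : Module.End ℝ H} {c : ι → ℝ} (hD : ∀ k, D (e k) = c k • e k) (r : ℝ) (k : ι) :
      (r • D) (e k) = (r * c k) • e k := by
    rw [LinearMap.smul_apply, hD, smul_smul]
  refine ⟨commute_of_diagonal e hA hT, isSymmetric_of_diagonal e hA,
    le_of_diagonal e hTA (hsmul hT s) fun k => ?_, le_of_diagonal e (hsmul hT (s / κ)) hTA
    fun k => ?_, le_of_diagonal e (hsmul hTA η) (a' := fun _ => 1) (fun k => ?_) fun k => ?_,
    le_of_diagonal e hATA (hsmul hTA s) fun k => ?_⟩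
  · rw [mul_comm]
    exact mul_le_mul_of_nonneg_right (has k) (hl k)
  · rw [mul_comm (l k)]
    exact mul_le_mul_of_nonneg_right (hκ k) (hl k)
  · rw [Module.End.one_apply, one_smul]
  · rw [← mul_assoc]
    exact hone k
  · exact mul_le_mul_of_nonneg_right (has k) (mul_nonneg (hl k) (ha k))

theorem localSteps_div_kappa_fedAvg {γ : ℝ} (hγ : 0 < γ) {s : ℕ} :
    (s : ℝ) / Algorithm.kappa γ (.fedAvg s) = ∑ τ ∈ Finset.range s, (1 - γ) ^ τ := by
  have hgeom : γ * ∑ τ ∈ Finset.range s, (1 - γ) ^ τ = 1 - (1 - γ) ^ s := by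
    simpa only [sub_sub_cancel] using mul_neg_geom_sum (1 - γ) s
  rcases Nat.eq_zero_or_pos s with rfl | hs
  · simp
  rw [Algorithm.kappa, ← hgeom, mul_div_mul_left _ _ hγ.ne', div_div_cancel₀]
  exact_mod_cast hs.ne'

theorem kappa_pos {γ : ℝ} (hγ : 0 < γ) {alg : Algorithm} (hs : 1 ≤ alg.localSteps)
    (h : alg ≠ .fedProx → γ < 1) : 0 < alg.kappa γ := by
  cases alg with
  | fedAvg s =>
    have hs : 0 < s := hs
    have hpow : (1 - γ) ^ s < 1 :=
      pow_lt_one₀ (sub_nonneg.mpr (h (by simp)).le) (by linarith) hs.ne'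
    exact div_pos (mul_pos hγ (Nat.cast_pos.mpr hs)) (by linarith)
  | fedProx => exact add_pos one_pos hγ

variable [FiniteDimensional ℝ H] {T : Module.End ℝ H} {η γ : ℝ}

theorem exists_eigenbasis_of_nonneg_of_smul_le (hT : 0 ≤ T) (hη : 0 ≤ η)
    (hTγ : η • T ≤ γ • (1 : Module.End ℝ H)) :
    ∃ (e : OrthonormalBasis (Fin (Module.finrank ℝ H)) ℝ H)
      (l : Fin (Module.finrank ℝ H) → ℝ), (∀ k, T (e k) = l k • e k) ∧
        ∀ k, 0 ≤ l k ∧ 0 ≤ η * l k ∧ η * l k ≤ γ := by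
  obtain ⟨e, l, he⟩ := exists_eigenbasis (isSymmetric_of_nonneg hT)
  have hl (k) : 0 ≤ l k := eigenvalue_le_of_le hT (e.norm_eq_one k) (by simp) (he k)
  exact ⟨e, l, he, fun k => ⟨hl k, mul_nonneg hη (hl k), eigenvalue_le_of_le hTγ (e.norm_eq_one k)
    (by rw [LinearMap.smul_apply, he, smul_smul]) (by simp)⟩⟩

theorem isLocalFilter_fedAvg (hT : 0 ≤ T) (hη : 0 ≤ η) (hγ : 0 < γ) (hγ1 : γ ≤ 1)
    (hTγ : η • T ≤ γ • (1 : Module.End ℝ H)) (s : ℕ) :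
    IsLocalFilter η s (Algorithm.kappa γ (.fedAvg s)) T
      (∑ τ ∈ Finset.range s, (1 - η • T) ^ τ) := by
  obtain ⟨e, l, he, hl⟩ := exists_eigenbasis_of_nonneg_of_smul_le hT hη hTγ
  have hstep (k) : (1 - η • T) (e k) = (1 - η * l k) • e k := by
    rw [LinearMap.sub_apply, LinearMap.smul_apply, he, Module.End.one_apply, sub_smul, one_smul,
      smul_smul]
  have hq (k) : 0 ≤ 1 - η * l k := sub_nonneg.mpr ((hl k).2.2.trans hγ1)
  refine isLocalFilter_of_eigenbasis e he
    (a := fun k => ∑ τ ∈ Finset.range s, (1 - η * l k) ^ τ) (fun k => ?_) (fun k => (hl k).1)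
    (fun k => Finset.sum_nonneg fun τ _ => pow_nonneg (hq k) τ) (fun k => ?_) (fun k => ?_)
    (fun k => ?_)
  · simp only [LinearMap.sum_apply, pow_apply_of_eigen (hstep k), Finset.sum_smul]
  · refine (Finset.sum_le_sum fun τ _ =>
      pow_le_one₀ (n := τ) (hq k) (sub_le_self 1 (hl k).2.1)).trans ?_
    simp
  · rw [localSteps_div_kappa_fedAvg hγ]
    exact Finset.sum_le_sum fun τ _ =>
      pow_le_pow_left₀ (sub_nonneg.mpr hγ1) (sub_le_sub_left (hl k).2.2 1) τ
  · have hgeom := mul_neg_geom_sum (1 - η * l k) s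
    rw [sub_sub_cancel] at hgeom
    rw [hgeom]
    exact sub_le_self 1 (pow_nonneg (hq k) s)

theorem isUnit_one_add_smul (hT : 0 ≤ T) (hη : 0 ≤ η) : IsUnit (1 + η • T) := by
  refine isUnit_of_smul_one_le one_pos ?_
  rw [one_smul]
  exact le_add_of_nonneg_right (by simpa using smul_le_smul_of_le hη hT)

theorem isLocalFilter_fedProx (hT : 0 ≤ T) (hη : 0 ≤ η)
    (hTγ : η • T ≤ γ • (1 : Module.End ℝ H)) :
    IsLocalFilter η 1 (Algorithm.kappa γ .fedProx) T (Ring.inverse (1 + η • T)) := by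
  obtain ⟨e, l, he, hl⟩ := exists_eigenbasis_of_nonneg_of_smul_le hT hη hTγ
  have hstep (k) : (1 + η • T) (e k) = (1 + η * l k) • e k := by
    rw [LinearMap.add_apply, LinearMap.smul_apply, he, Module.End.one_apply, add_smul, one_smul,
      smul_smul]
  have hpos (k) : 0 < 1 + η * l k := add_pos_of_pos_of_nonneg one_pos (hl k).2.1
  have hinv (k) : Ring.inverse (1 + η • T) (e k) = (1 + η * l k)⁻¹ • e k := by
    have h := DFunLike.congr_fun (Ring.inverse_mul_cancel _ (isUnit_one_add_smul hT hη)) (e k)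
    rw [Module.End.mul_apply, hstep, map_smul, Module.End.one_apply] at h
    rw [eq_inv_smul_iff₀ (hpos k).ne', h]
  refine isLocalFilter_of_eigenbasis e he hinv (fun k => (hl k).1)
    (fun k => (inv_pos.mpr (hpos k)).le)
    (fun k => inv_le_one_of_one_le₀ (le_add_of_nonneg_right (hl k).2.1)) (fun k => ?_)
    (fun k => ?_)
  · rw [Algorithm.kappa, one_div]
    exact inv_anti₀ (hpos k) (add_le_add_right (hl k).2.2 1)
  · rw [← div_eq_mul_inv, div_le_one (hpos k)]
    exact le_add_of_nonneg_left zero_le_one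

variable {L : Module.End ℝ H} {ρ : ℝ}

theorem exists_eigenbasis_of_smul_one_le_one_sub (hL : 0 ≤ L)
    (hLρ : ρ • (1 : Module.End ℝ H) ≤ 1 - L) :
    ∃ (e : OrthonormalBasis (Fin (Module.finrank ℝ H)) ℝ H)
      (l : Fin (Module.finrank ℝ H) → ℝ), (∀ k, L (e k) = l k • e k) ∧
        ∀ k, 0 ≤ l k ∧ ρ ≤ 1 - l k := by
  obtain ⟨e, l, he⟩ := exists_eigenbasis (isSymmetric_of_nonneg hL)
  exact ⟨e, l, he, fun k => ⟨eigenvalue_le_of_le hL (e.norm_eq_one k) (by simp) (he k),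
    eigenvalue_le_of_le hLρ (e.norm_eq_one k) (by simp)
      (by rw [LinearMap.sub_apply, he, Module.End.one_apply, sub_smul, one_smul])⟩⟩

theorem norm_pow_apply_sq_le (hL : 0 ≤ L) (hLρ : ρ • (1 : Module.End ℝ H) ≤ 1 - L) (t : ℕ)
    (f : H) : ‖(L ^ t) f‖ ^ 2 ≤ (1 - ρ) ^ (2 * t) * ‖f‖ ^ 2 := by
  obtain ⟨e, l, he, hl⟩ := exists_eigenbasis_of_smul_one_le_one_sub hL hLρ
  rw [← e.sum_sq_inner_right, ← e.sum_sq_inner_right, Finset.mul_sum]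
  refine Finset.sum_le_sum fun k _ => ?_
  rw [inner_basis_apply_of_diagonal e fun k => pow_apply_of_eigen (he k) t, mul_pow, ← pow_mul,
    mul_comm t]
  have := pow_le_pow_left₀ (hl k).1 (le_sub_comm.mp (hl k).2) (2 * t)
  gcongr

theorem geom_sum_sq_mul_le {l c q : ℝ} (hρ : 0 < ρ) (hl : 0 ≤ l) (hlρ : ρ ≤ 1 - l) (hc : 0 ≤ c)
    (hq : q ≤ c * (1 - l)) (t : ℕ) :
    (∑ τ ∈ Finset.range t, l ^ τ) ^ 2 * q ≤ c / ρ := by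
  set v := ∑ τ ∈ Finset.range t, l ^ τ with hv
  have hv0 : 0 ≤ v := Finset.sum_nonneg fun τ _ => pow_nonneg hl τ
  have hv' : 0 ≤ (1 - l) * v := mul_nonneg (hρ.le.trans hlρ) hv0
  have hv1 : (1 - l) * v ≤ 1 := by
    rw [hv, mul_neg_geom_sum]
    exact sub_le_self 1 (pow_nonneg hl t)
  have hvρ : v ≤ 1 / ρ := by
    rw [le_div_iff₀' hρ]
    exact (mul_le_mul_of_nonneg_right hlρ hv0).trans hv1
  calc v ^ 2 * q ≤ v ^ 2 * (c * (1 - l)) := by gcongr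
    _ = c * (v * ((1 - l) * v)) := by ring
    _ ≤ c * (1 / ρ * 1) := by gcongr
    _ = c / ρ := by ring

theorem sum_norm_sum_pow_apply_sq_le (hL : 0 ≤ L) (hρ : 0 < ρ)
    (hLρ : ρ • (1 : Module.End ℝ H) ≤ 1 - L) {ι : Type*} [Fintype ι] {ψ : ι → H} {c : ℝ}
    (hc : 0 ≤ c) (hψ : ∀ f, ∑ p, ⟪ψ p, f⟫_ℝ ^ 2 ≤ c * ⟪(1 - L) f, f⟫_ℝ) (t : ℕ) :
    ∑ p, ‖∑ τ ∈ Finset.range t, (L ^ τ) (ψ p)‖ ^ 2 ≤ Module.finrank ℝ H * (c / ρ) := by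
  obtain ⟨e, l, he, hl⟩ := exists_eigenbasis_of_smul_one_le_one_sub hL hLρ
  have hpow (τ k f) : ⟪e k, (L ^ τ) f⟫_ℝ = l k ^ τ * ⟪e k, f⟫_ℝ :=
    inner_basis_apply_of_diagonal e (fun k => pow_apply_of_eigen (he k) τ) k f
  have hψk (k) : ∑ p, ⟪e k, ψ p⟫_ℝ ^ 2 ≤ c * (1 - l k) := by
    simpa [he, inner_sub_left, real_inner_smul_right, real_inner_comm] using hψ (e k)
  calc ∑ p, ‖∑ τ ∈ Finset.range t, (L ^ τ) (ψ p)‖ ^ 2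
      = ∑ k, (∑ τ ∈ Finset.range t, l k ^ τ) ^ 2 * ∑ p, ⟪e k, ψ p⟫_ℝ ^ 2 := by
        simp only [← e.sum_sq_inner_right, inner_sum, hpow, ← Finset.sum_mul, mul_pow]
        rw [Finset.sum_comm]
        simp only [← Finset.mul_sum]
    _ ≤ ∑ _k : Fin (Module.finrank ℝ H), c / ρ :=
        Finset.sum_le_sum fun k _ => geom_sum_sq_mul_le hρ (hl k).1 (hl k).2 hc (hψk k) t
    _ = Module.finrank ℝ H * (c / ρ) := by simp

end Operators

section Client

theorem argmin_eq_of_forall_lt {H : Type*} [Nonempty H] {J : H → ℝ} {f : H}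
    (h : ∀ g ≠ f, J f < J g) : argmin J = f := by
  have hf : IsMinOn J Set.univ f := fun g _ => by
    rcases eq_or_ne g f with rfl | hg
    · exact le_refl (J g)
    · exact (h g hg).le
  have hmin : IsMinOn J Set.univ (argmin J) := Classical.epsilon_spec ⟨f, hf⟩
  by_contra hne
  exact (h _ hne).not_ge (hmin (Set.mem_univ f))

theorem iterate_apply_of_affine {R E : Type*} [Semiring R] [AddCommMonoid E] [Module R E]
    {S : E → E} {Y : Module.End R E} {u : E} (hS : ∀ g, S g = Y g + u) (s : ℕ) (g : E) :
    S^[s] g = (Y ^ s) g + (∑ τ ∈ Finset.range s, Y ^ τ) u := by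
  induction s with
  | zero => simp
  | succ s ih =>
    rw [Function.iterate_succ_apply', ih, hS, map_add, Finset.sum_range_succ', pow_succ',
      LinearMap.add_apply, pow_zero, Module.End.one_apply, Module.End.mul_apply,
      ← Module.End.mul_apply Y (∑ τ ∈ _, _), Finset.mul_sum, add_assoc]
    simp only [pow_succ']

theorem dotProduct_mulVec_le_specNorm {k : ℕ} (A : Matrix (Fin k) (Fin k) ℝ) (v : Fin k → ℝ) :
    v ⬝ᵥ (A *ᵥ v) ≤ specNorm A * (v ⬝ᵥ v) := by
  set w := WithLp.toLp 2 v with hw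
  have hAv : v ⬝ᵥ (A *ᵥ v) = ⟪w, toEuclideanCLM (n := Fin k) (𝕜 := ℝ) A w⟫_ℝ := by
    simp [hw, EuclideanSpace.inner_eq_star_dotProduct, dotProduct_comm]
  have hv : v ⬝ᵥ v = ‖w‖ ^ 2 := by
    rw [EuclideanSpace.real_norm_sq_eq]
    simp only [hw, dotProduct, pow_two]
  rw [hAv, hv, specNorm]
  calc ⟪w, toEuclideanCLM (n := Fin k) (𝕜 := ℝ) A w⟫_ℝ
      ≤ ‖w‖ * ‖toEuclideanCLM (n := Fin k) (𝕜 := ℝ) A w‖ := real_inner_le_norm _ _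
    _ ≤ ‖w‖ * (‖toEuclideanCLM (n := Fin k) (𝕜 := ℝ) A‖ * ‖w‖) := by
        gcongr
        exact ContinuousLinearMap.le_opNorm _ _
    _ = ‖toEuclideanCLM (n := Fin k) (𝕜 := ℝ) A‖ * ‖w‖ ^ 2 := by ring

variable {X H : Type*} [NormedAddCommGroup H] [InnerProductSpace ℝ H] [CompleteSpace H]
  [RKHS ℝ H X ℝ]

theorem inner_rep_left (x : X) (f : H) : ⟪rep H x, f⟫_ℝ = f x := by
  rw [rep, RKHS.kerFun_inner]
  simp

variable {m : ℕ} (x : Fin m → X) (y : Fin m → ℝ)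

variable (H) in
/-- The adjoint of the sampling map `f ↦ (f(x_1), …, f(x_m))`, for the inner product on `ℝ^m`
normalized by `1/m`. -/
noncomputable def sampleAdjoint : H :=
  (1 / (m : ℝ)) • ∑ j, y j • rep H (x j)

theorem inner_sampleAdjoint (f : H) :
    ⟪sampleAdjoint H x y, f⟫_ℝ = (1 / (m : ℝ)) * ∑ j, y j * f (x j) := by
  simp only [sampleAdjoint, real_inner_smul_left, sum_inner, inner_rep_left]

theorem sampleOp_apply (f : H) : sampleOp H x f = sampleAdjoint H x fun j => f (x j) := rfl

theorem inner_sampleOp (f g : H) :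
    ⟪sampleOp H x f, g⟫_ℝ = (1 / (m : ℝ)) * ∑ j, f (x j) * g (x j) :=
  inner_sampleAdjoint x _ g

theorem sampleOp_nonneg : 0 ≤ sampleOp H x := by
  refine (LinearMap.nonneg_iff_isPositive _).mpr ⟨fun f g => ?_, fun f => ?_⟩
  · rw [inner_sampleOp, real_inner_comm, inner_sampleOp]
    simp only [mul_comm]
  · rw [inner_sampleOp]
    exact mul_nonneg (by positivity) (Finset.sum_nonneg fun j _ => mul_self_nonneg _)

theorem norm_sampleOp_sq (f : H) : ‖sampleOp H x f‖ ^ 2 =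
    (1 / (m : ℝ)) * ((fun j => f (x j)) ⬝ᵥ (gram H x *ᵥ fun j => f (x j))) := by
  have heval (j : Fin m) : sampleOp H x f (x j) = (gram H x *ᵥ fun l => f (x l)) j := by
    rw [← inner_rep_left, sampleOp_apply, real_inner_comm, inner_sampleAdjoint, mulVec, dotProduct,
      Finset.mul_sum]
    refine Finset.sum_congr rfl fun l _ => ?_
    rw [gram, of_apply, ← inner_rep_left (x j) (rep H (x l)), real_inner_comm, inner_rep_left]
    ring
  rw [← real_inner_self_eq_norm_sq, inner_sampleOp, dotProduct]
  simp only [heval]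

theorem sampleOp_le : sampleOp H x ≤ specNorm (gram H x) • (1 : Module.End ℝ H) := by
  refine le_smul_one_of_norm_apply_sq_le (sampleOp_nonneg x) (norm_nonneg _) fun f => ?_
  rw [norm_sampleOp_sq, inner_sampleOp, mul_left_comm]
  exact mul_le_mul_of_nonneg_left (dotProduct_mulVec_le_specNorm _ _) (by positivity)

theorem hasGradientAt_empRisk (g : H) :
    HasGradientAt (empRisk (H := H) x y) (sampleOp H x g - sampleAdjoint H x y) g := by
  rw [hasGradientAt_iff_hasFDerivAt]
  have heval (j : Fin m) : HasFDerivAt (fun f : H => f (x j)) (innerSL ℝ (rep H (x j))) g := by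
    have hinner : (fun f : H => f (x j)) = innerSL ℝ (rep H (x j)) :=
      funext fun f => (inner_rep_left (x j) f).symm
    rw [hinner]
    exact ContinuousLinearMap.hasFDerivAt _
  have hrisk : HasFDerivAt (empRisk (H := H) x y) _ g :=
    (HasFDerivAt.fun_sum (u := Finset.univ) fun j _ =>
      ((heval j).sub_const (y j)).pow 2).const_mul (1 / (2 * (m : ℝ)))
  refine hrisk.congr_fderiv ?_
  ext f
  simp only [_root_.smul_apply, _root_.sum_apply, _root_.sub_apply, coe_innerSL_apply, smul_eq_mul,
    inner_rep_left, map_sub, InnerProductSpace.toDual_apply_apply, inner_sampleOp,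
    inner_sampleAdjoint, Finset.mul_sum, ← Finset.sum_sub_distrib]
  refine Finset.sum_congr rfl fun j _ => ?_
  ring

theorem gradStep_eq (η : ℝ) (g : H) :
    gradStep η x y g = (1 - η • sampleOp H x) g + η • sampleAdjoint H x y := by
  rw [gradStep, (hasGradientAt_empRisk x y g).gradient, LinearMap.sub_apply, LinearMap.smul_apply,
    Module.End.one_apply, smul_sub]
  abel

theorem empRisk_add (f h : H) : empRisk x y (f + h) = empRisk x y f +
    ⟪sampleOp H x f - sampleAdjoint H x y, h⟫_ℝ + 1 / 2 * ⟪sampleOp H x h, h⟫_ℝ := by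
  rw [empRisk, empRisk, inner_sub_left, inner_sampleOp, inner_sampleOp, inner_sampleAdjoint,
    ← one_div_mul_one_div]
  simp only [Finset.mul_sum, ← Finset.sum_sub_distrib, ← Finset.sum_add_distrib, RKHS.coe_add,
    Pi.add_apply]
  exact Finset.sum_congr rfl fun j _ => by ring

theorem proxObjective_add {η : ℝ} (hη : η ≠ 0) {g f : H}
    (hf : (1 + η • sampleOp H x) f = g + η • sampleAdjoint H x y) (h : H) :
    proxObjective η x y g (f + h) = proxObjective η x y g f +
      (1 / 2 * ⟪sampleOp H x h, h⟫_ℝ + 1 / (2 * η) * ‖h‖ ^ 2) := by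
  have hstat : η * ⟪sampleOp H x f - sampleAdjoint H x y, h⟫_ℝ = -⟪f - g, h⟫_ℝ := by
    rw [LinearMap.add_apply, LinearMap.smul_apply, Module.End.one_apply, ← sub_eq_zero] at hf
    rw [← real_inner_smul_left, ← inner_neg_left, smul_sub]
    refine congrArg (⟪·, h⟫_ℝ) (sub_eq_zero.mp (Eq.trans ?_ hf))
    abel
  rw [proxObjective, proxObjective, empRisk_add, add_sub_right_comm, norm_add_sq_real]
  field_simp
  linear_combination 2 * hstat

theorem argmin_proxObjective [FiniteDimensional ℝ H] {η : ℝ} (hη : 0 < η) (g : H) :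
    argmin (proxObjective η x y g) =
      Ring.inverse (1 + η • sampleOp H x) (g + η • sampleAdjoint H x y) := by
  have hu := isUnit_one_add_smul (sampleOp_nonneg (H := H) x) hη.le
  have hstat : (1 + η • sampleOp H x) (Ring.inverse (1 + η • sampleOp H x)
      (g + η • sampleAdjoint H x y)) = g + η • sampleAdjoint H x y := by
    rw [← Module.End.mul_apply, Ring.mul_inverse_cancel _ hu, Module.End.one_apply]
  refine argmin_eq_of_forall_lt fun f hf => ?_
  have hadd := proxObjective_add x y hη.ne' hstat (f - Ring.inverse (1 + η • sampleOp H x)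
    (g + η • sampleAdjoint H x y))
  rw [add_sub_cancel] at hadd
  rw [hadd]
  refine lt_add_of_pos_right _ (add_pos_of_nonneg_of_pos ?_ ?_)
  · exact mul_nonneg one_half_pos.le
      (((LinearMap.nonneg_iff_isPositive _).mp (sampleOp_nonneg x)).inner_nonneg_left _)
  · have := norm_pos_iff.mpr (sub_ne_zero.mpr hf)
    positivity

variable (H) in
/-- The spectral filter `A` that a client applies to its data in one round: with `T` the sample
operator, `∑_{τ<s} (1 - η T)^τ` for FedAvg and `(1 + η T)⁻¹` for FedProx. -/
noncomputable def localFilter (alg : Algorithm) (η : ℝ) : Module.End ℝ H :=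
  match alg with
  | .fedAvg s => ∑ τ ∈ Finset.range s, (1 - η • sampleOp H x) ^ τ
  | .fedProx => Ring.inverse (1 + η • sampleOp H x)

theorem clientPsi_eq (alg : Algorithm) (η : ℝ) (j : Fin m) :
    clientPsi H alg η x j = (η / m) • localFilter H x alg η (rep H (x j)) := by
  cases alg with
  | fedAvg s => rw [clientPsi, localFilter, LinearMap.sum_apply]
  | fedProx => rfl

theorem sum_smul_clientPsi (alg : Algorithm) (η : ℝ) :
    ∑ j, y j • clientPsi H alg η x j = η • localFilter H x alg η (sampleAdjoint H x y) := by
  simp only [clientPsi_eq, sampleAdjoint, map_smul, map_sum, Finset.smul_sum, smul_smul]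
  exact Finset.sum_congr rfl fun j _ => by ring_nf

theorem sum_inner_clientPsi_sq {alg : Algorithm} {η : ℝ}
    (hA : (localFilter H x alg η).IsSymmetric) (f : H) :
    ∑ j, ⟪clientPsi H alg η x j, f⟫_ℝ ^ 2 =
      η ^ 2 / m * ⟪(localFilter H x alg η * sampleOp H x * localFilter H x alg η) f, f⟫_ℝ := by
  have hΨ (j : Fin m) : ⟪clientPsi H alg η x j, f⟫_ℝ = η / m * localFilter H x alg η f (x j) := by
    rw [clientPsi_eq, real_inner_smul_left, hA, inner_rep_left]
  simp only [hΨ, Module.End.mul_apply, hA _ f, inner_sampleOp, mul_pow, ← Finset.mul_sum, ← pow_two]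
  ring

variable [FiniteDimensional ℝ H] {η : ℝ}

theorem clientOp_eq (alg : Algorithm) (hη : 0 ≤ η) :
    clientOp H alg η x = 1 - η • (sampleOp H x * localFilter H x alg η) := by
  cases alg with
  | fedAvg s =>
    have hgeom := mul_neg_geom_sum (1 - η • sampleOp H x) s
    rw [sub_sub_cancel, smul_mul_assoc] at hgeom
    rw [clientOp, localFilter, hgeom, sub_sub_cancel]
  | fedProx =>
    have hinv := Ring.mul_inverse_cancel _ (isUnit_one_add_smul (sampleOp_nonneg (H := H) x) hη)
    rw [add_mul, one_mul, smul_mul_assoc] at hinv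
    exact eq_sub_of_add_eq hinv

theorem localUpdate_eq (alg : Algorithm) (hη : 0 < η) (g : H) :
    localUpdate alg η x y g = clientOp H alg η x g + ∑ j, y j • clientPsi H alg η x j := by
  rw [sum_smul_clientPsi, ← map_smul]
  cases alg with
  | fedAvg s => exact iterate_apply_of_affine (gradStep_eq x y η) s g
  | fedProx =>
    rw [localUpdate, argmin_proxObjective x y hη, map_add]
    rfl

theorem isLocalFilter_localFilter {alg : Algorithm} {γ : ℝ} (hη : 0 ≤ η) (hγ : 0 < γ)
    (hγ1 : alg ≠ .fedProx → γ ≤ 1) (hx : η * specNorm (gram H x) ≤ γ) :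
    IsLocalFilter η alg.localSteps (alg.kappa γ) (sampleOp H x) (localFilter H x alg η) := by
  have hT : η • sampleOp H x ≤ γ • (1 : Module.End ℝ H) := by
    refine (smul_le_smul_of_le hη (sampleOp_le x)).trans ?_
    rw [smul_smul]
    exact smul_one_le_smul_one hx
  cases alg with
  | fedAvg s => exact isLocalFilter_fedAvg (sampleOp_nonneg x) hη hγ (hγ1 (by simp)) hT s
  | fedProx =>
    simpa only [Algorithm.localSteps, Nat.cast_one] using!
      isLocalFilter_fedProx (sampleOp_nonneg x) hη hT

end Client

section Noise

variable {ι : Type*} {σ : ℝ} {P : Measure (ι → ℝ)}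

theorem IsNoiseLaw.integral_mul_eq_zero (hP : IsNoiseLaw σ P) {p q : ι} (hpq : p ≠ q) :
    ∫ ξ, ξ p * ξ q ∂P = 0 := by
  rw [(hP.indep.indepFun hpq).integral_fun_mul_eq_mul_integral (hP.memLp p).aestronglyMeasurable
    (hP.memLp q).aestronglyMeasurable, hP.mean, zero_mul]

theorem IsNoiseLaw.integral_mul_self_le (hP : IsNoiseLaw σ P) (p : ι) :
    ∫ ξ, ξ p * ξ p ∂P ≤ σ ^ 2 := by
  have h := hP.var p
  rw [variance_of_integral_eq_zero (hP.memLp p).aemeasurable (hP.mean p)] at h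
  simpa only [pow_two] using h

variable [Fintype ι] {H : Type*} [NormedAddCommGroup H] [InnerProductSpace ℝ H]

theorem norm_add_sum_smul_sq (c : H) (v : ι → H) (ξ : ι → ℝ) :
    ‖c + ∑ p, ξ p • v p‖ ^ 2 =
      ‖c‖ ^ 2 + ∑ p, ξ p * (2 * ⟪c, v p⟫_ℝ) + ∑ p, ∑ q, ξ p * ξ q * ⟪v p, v q⟫_ℝ := by
  rw [norm_add_sq_real, ← real_inner_self_eq_norm_sq (∑ p, ξ p • v p)]
  simp only [inner_sum, sum_inner, real_inner_smul_left, real_inner_smul_right, Finset.mul_sum,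
    mul_left_comm (2 : ℝ), mul_assoc]
  rw [Finset.sum_comm (f := fun p q => ξ p * (ξ q * ⟪v q, v p⟫_ℝ))]
  simp only [mul_left_comm (ξ _) (ξ _)]

theorem IsNoiseLaw.integrable_and_integral_norm_sq_le [IsProbabilityMeasure P] (hP : IsNoiseLaw σ P)
    (c : H) (v : ι → H) :
    Integrable (fun ξ : ι → ℝ => ‖c + ∑ p, ξ p • v p‖ ^ 2) P ∧
    ∫ ξ : ι → ℝ, ‖c + ∑ p, ξ p • v p‖ ^ 2 ∂P ≤ ‖c‖ ^ 2 + σ ^ 2 * ∑ p, ‖v p‖ ^ 2 := by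
  have hlin (p : ι) : Integrable (fun ξ : ι → ℝ => ξ p * (2 * ⟪c, v p⟫_ℝ)) P :=
    ((hP.memLp p).integrable one_le_two).mul_const _
  have hquad (p q : ι) : Integrable (fun ξ : ι → ℝ => ξ p * ξ q * ⟪v p, v q⟫_ℝ) P :=
    ((hP.memLp p).integrable_mul (hP.memLp q)).mul_const _
  have hquad' (p : ι) : Integrable (fun ξ : ι → ℝ => ∑ q, ξ p * ξ q * ⟪v p, v q⟫_ℝ) P :=
    integrable_finsetSum _ fun q _ => hquad p q
  have haff : Integrable (fun ξ : ι → ℝ => ‖c‖ ^ 2 + ∑ p, ξ p * (2 * ⟪c, v p⟫_ℝ)) P :=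
    (integrable_const _).add (integrable_finsetSum _ fun p _ => hlin p)
  have hsum : Integrable (fun ξ : ι → ℝ => ∑ p, ∑ q, ξ p * ξ q * ⟪v p, v q⟫_ℝ) P :=
    integrable_finsetSum _ fun p _ => hquad' p
  simp only [norm_add_sum_smul_sq]
  refine ⟨haff.add hsum, ?_⟩
  rw [integral_add haff hsum, integral_add (integrable_const _) (integrable_finsetSum _
    fun p _ => hlin p), integral_finsetSum _ fun p _ => hquad' p,
    integral_finsetSum _ fun p _ => hlin p]
  simp only [integral_mul_const, hP.mean, zero_mul, Finset.sum_const_zero, add_zero,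
    integral_const, probReal_univ, one_smul]
  gcongr
  rw [Finset.mul_sum]
  refine Finset.sum_le_sum fun p _ => ?_
  rw [integral_finsetSum _ fun q _ => hquad p q, Finset.sum_eq_single_of_mem p (Finset.mem_univ p)]
  · rw [integral_mul_const, real_inner_self_eq_norm_sq]
    exact mul_le_mul_of_nonneg_right (hP.integral_mul_self_le p) (sq_nonneg _)
  · intro q _ hq
    rw [integral_mul_const, hP.integral_mul_eq_zero hq.symm, zero_mul]

end Noise

section Global

variable {X H : Type*} [NormedAddCommGroup H] [InnerProductSpace ℝ H] [CompleteSpace H]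
  [RKHS ℝ H X ℝ] {M : ℕ} {n : Fin M → ℕ}

theorem weight_nonneg (n : Fin M → ℕ) (i : Fin M) : 0 ≤ weight n i :=
  div_nonneg (Nat.cast_nonneg _) (Nat.cast_nonneg _)

theorem sum_weight (hn : 0 < ∑ i, n i) : ∑ i, weight n i = 1 := by
  simp only [weight, ← Finset.sum_div]
  rw [← Nat.cast_sum, div_self (Nat.cast_ne_zero.mpr hn.ne')]

theorem modelGap_nonneg {H : Type*} [NormedAddCommGroup H] (fStar : Fin M → H) :
    0 ≤ modelGap fStar :=
  Real.iSup_nonneg fun _ => norm_nonneg _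

theorem norm_sub_le_modelGap {H : Type*} [NormedAddCommGroup H] (fStar : Fin M → H) (i j : Fin M) :
    ‖fStar i - fStar j‖ ≤ modelGap fStar :=
  le_ciSup (f := fun p : Fin M × Fin M => ‖fStar p.1 - fStar p.2‖)
    (Set.finite_range _).bddAbove (i, j)

variable {alg : Algorithm} {η κ : ℝ} {x : (i : Fin M) → Fin (n i) → X}

theorem specNorm_gram_le_iSup (i : Fin M) :
    specNorm (gram H (x i)) ≤ ⨆ i, specNorm (gram H (x i)) :=
  le_ciSup (f := fun i => specNorm (gram H (x i))) (Set.finite_range _).bddAbove i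

theorem one_sub_globalOp (hn : 0 < ∑ i, n i) :
    1 - globalOp H alg η x = ∑ i, weight n i • (1 - clientOp H alg η (x i)) := by
  simp only [globalOp, smul_sub, Finset.sum_sub_distrib, ← Finset.sum_smul, sum_weight hn, one_smul]

theorem one_sub_globalOp_apply_fBar (hu : IsUnit (1 - globalOp H alg η x)) (fStar : Fin M → H) :
    (1 - globalOp H alg η x) (fBar alg η x fStar) =
      dotPsi H alg η x fun i j => fStar i (x i j) := by
  rw [fBar, ← Module.End.mul_apply, Ring.mul_inverse_cancel _ hu, Module.End.one_apply]

theorem dotPsi_responses (fStar : Fin M → H) (ξ : (Σ i : Fin M, Fin (n i)) → ℝ) :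
    dotPsi H alg η x (responses x fStar ξ) =
      dotPsi H alg η x (fun i j => fStar i (x i j)) +
        ∑ p, ξ p • (weight n p.1 • clientPsi H alg η (x p.1) p.2) := by
  simp only [Fintype.sum_sigma, dotPsi, responses, add_smul, Finset.sum_add_distrib, smul_add,
    Finset.smul_sum, smul_comm (ξ _)]

variable [FiniteDimensional ℝ H]

theorem globalModel_succ (hη : 0 < η) (y : (i : Fin M) → Fin (n i) → ℝ) (f₀ : H) (t : ℕ) :
    globalModel alg η x y f₀ (t + 1) =
      globalOp H alg η x (globalModel alg η x y f₀ t) + dotPsi H alg η x y := by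
  simp only [globalModel, localUpdate_eq _ _ alg hη, smul_add, Finset.sum_add_distrib, globalOp,
    dotPsi, LinearMap.sum_apply, LinearMap.smul_apply]

theorem globalModel_sub_fBar (hη : 0 < η) (hu : IsUnit (1 - globalOp H alg η x))
    (fStar : Fin M → H) (ξ : (Σ i : Fin M, Fin (n i)) → ℝ) (f₀ : H) (t : ℕ) :
    globalModel alg η x (responses x fStar ξ) f₀ t - fBar alg η x fStar =
      (globalOp H alg η x ^ t) (f₀ - fBar alg η x fStar) +
        ∑ p, ξ p • ∑ τ ∈ Finset.range t,
          (globalOp H alg η x ^ τ) (weight n p.1 • clientPsi H alg η (x p.1) p.2) := by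
  set u := ∑ p, ξ p • (weight n p.1 • clientPsi H alg η (x p.1) p.2) with hu_def
  have hiter : globalModel alg η x (responses x fStar ξ) f₀ t - fBar alg η x fStar =
      (fun g => globalOp H alg η x g + u)^[t] (f₀ - fBar alg η x fStar) := by
    induction t with
    | zero => rfl
    | succ t ih =>
      rw [Function.iterate_succ_apply', ← ih, globalModel_succ hη, dotPsi_responses,
        ← one_sub_globalOp_apply_fBar hu, map_sub, LinearMap.sub_apply, Module.End.one_apply]
      abel
  rw [hiter, iterate_apply_of_affine (fun _ => rfl), hu_def, map_sum]
  simp only [map_smul, LinearMap.sum_apply, Finset.smul_sum]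

theorem sum_apply_smul_clientPsi {m : ℕ} {x : Fin m → X} (hη : 0 ≤ η)
    (hA : Commute (localFilter H x alg η) (sampleOp H x)) (f : H) :
    ∑ j, f (x j) • clientPsi H alg η x j = (1 - clientOp H alg η x) f := by
  rw [sum_smul_clientPsi x (fun j => f (x j)), ← sampleOp_apply, clientOp_eq x alg hη,
    sub_sub_cancel, ← hA.eq, LinearMap.smul_apply, Module.End.mul_apply]

theorem clientOp_le_one {m : ℕ} {x : Fin m → X} (hη : 0 ≤ η) (hκ : 0 ≤ κ)
    (hA : IsLocalFilter η alg.localSteps κ (sampleOp H x) (localFilter H x alg η)) :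
    clientOp H alg η x ≤ 1 := by
  have hT : 0 ≤ (alg.localSteps / κ) • sampleOp H x := by
    simpa only [smul_zero] using
      smul_le_smul_of_le (div_nonneg (Nat.cast_nonneg _) hκ) (sampleOp_nonneg (H := H) x)
  rw [clientOp_eq x alg hη]
  refine sub_le_self 1 ?_
  simpa only [smul_zero] using smul_le_smul_of_le hη (hT.trans hA.le_mul)

theorem inner_one_sub_clientOp_le {m : ℕ} {x : Fin m → X} {b : ℝ} (hη : 0 ≤ η)
    (hA : IsLocalFilter η alg.localSteps κ (sampleOp H x) (localFilter H x alg η))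
    (hb : sampleOp H x ≤ b • 1) (f : H) :
    ⟪(1 - clientOp H alg η x) f, f⟫_ℝ ≤ alg.localSteps * η * b * ‖f‖ ^ 2 := by
  have hle : 1 - clientOp H alg η x ≤ (alg.localSteps * η * b) • (1 : Module.End ℝ H) := by
    rw [clientOp_eq x alg hη, sub_sub_cancel, mul_comm (alg.localSteps : ℝ), mul_assoc, mul_smul,
      mul_smul]
    exact smul_le_smul_of_le hη (hA.mul_le.trans (smul_le_smul_of_le (Nat.cast_nonneg _) hb))
  simpa only [inner_smul_one_apply_self] using inner_apply_self_le_of_le hle f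

theorem inner_one_sub_globalOp_fBar_sub_le (hη : 0 ≤ η) (hn : 0 < ∑ i, n i)
    (hA : ∀ i, Commute (localFilter H (x i) alg η) (sampleOp H (x i)))
    (hC : ∀ i, clientOp H alg η (x i) ≤ 1) (hu : IsUnit (1 - globalOp H alg η x))
    (fStar : Fin M → H) (g : H) :
    ⟪(1 - globalOp H alg η x) (fBar alg η x fStar - g), fBar alg η x fStar - g⟫_ℝ ≤
      ∑ i, weight n i * ⟪(1 - clientOp H alg η (x i)) (fStar i - g), fStar i - g⟫_ℝ := by
  have hB (i : Fin M) : 0 ≤ weight n i • (1 - clientOp H alg η (x i)) := by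
    simpa only [smul_zero] using
      smul_le_smul_of_le (weight_nonneg n i) (sub_nonneg.mpr (hC i))
  have hfix : ∑ i, (weight n i • (1 - clientOp H alg η (x i))) (fBar alg η x fStar - g) =
      ∑ i, (weight n i • (1 - clientOp H alg η (x i))) (fStar i - g) := by
    simp only [map_sub _ _ g, Finset.sum_sub_distrib]
    rw [← LinearMap.sum_apply, ← one_sub_globalOp hn, one_sub_globalOp_apply_fBar hu, dotPsi]
    simp only [sum_apply_smul_clientPsi hη (hA _), LinearMap.smul_apply]
  rw [one_sub_globalOp hn, LinearMap.sum_apply, sum_inner]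
  refine (sum_inner_le_sum_inner_of_sum_apply_eq hB hfix).trans_eq ?_
  simp only [LinearMap.smul_apply, real_inner_smul_left]

theorem globalOp_nonneg (hη : 0 ≤ η)
    (hA : ∀ i, IsLocalFilter η alg.localSteps κ (sampleOp H (x i)) (localFilter H (x i) alg η)) :
    0 ≤ globalOp H alg η x := by
  refine Finset.sum_nonneg fun i _ => ?_
  have hC : 0 ≤ clientOp H alg η (x i) := by
    rw [clientOp_eq (x i) alg hη]
    exact sub_nonneg.mpr (hA i).smul_mul_le_one
  simpa only [smul_zero] using smul_le_smul_of_le (weight_nonneg n i) hC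

theorem smul_one_le_one_sub_globalOp (hη : 0 ≤ η) (hκ : 0 ≤ κ) (hn : 0 < ∑ i, n i)
    (hA : ∀ i, IsLocalFilter η alg.localSteps κ (sampleOp H (x i)) (localFilter H (x i) alg η))
    {a : ℝ} (ha : a • (1 : Module.End ℝ H) ≤ ∑ i, weight n i • sampleOp H (x i)) :
    (alg.localSteps * η * a / κ) • (1 : Module.End ℝ H) ≤ 1 - globalOp H alg η x := by
  calc (alg.localSteps * η * a / κ) • (1 : Module.End ℝ H)
      = (η * (alg.localSteps / κ)) • a • (1 : Module.End ℝ H) := by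
        rw [smul_smul]
        congr 1
        ring
    _ ≤ (η * (alg.localSteps / κ)) • ∑ i, weight n i • sampleOp H (x i) :=
        smul_le_smul_of_le (by positivity) ha
    _ = ∑ i, weight n i • η • (alg.localSteps / κ) • sampleOp H (x i) := by
        simp only [Finset.smul_sum, smul_smul, mul_comm (weight n _), mul_assoc]
    _ ≤ ∑ i, weight n i • (1 - clientOp H alg η (x i)) := by
        refine Finset.sum_le_sum fun i _ => smul_le_smul_of_le (weight_nonneg n i) ?_
        rw [clientOp_eq (x i) alg hη, sub_sub_cancel]
        exact smul_le_smul_of_le hη (hA i).le_mul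
    _ = 1 - globalOp H alg η x := (one_sub_globalOp hn).symm

theorem sum_inner_weight_smul_clientPsi_sq_le (hη : 0 ≤ η) (hn : 0 < ∑ i, n i)
    (hA : ∀ i, IsLocalFilter η alg.localSteps κ (sampleOp H (x i)) (localFilter H (x i) alg η))
    (f : H) :
    ∑ p : Σ i, Fin (n i), ⟪weight n p.1 • clientPsi H alg η (x p.1) p.2, f⟫_ℝ ^ 2 ≤
      η * alg.localSteps / ((∑ i, n i : ℕ) : ℝ) * ⟪(1 - globalOp H alg η x) f, f⟫_ℝ := by
  rw [Fintype.sum_sigma, one_sub_globalOp hn, LinearMap.sum_apply, sum_inner, Finset.mul_sum]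
  refine Finset.sum_le_sum fun i _ => ?_
  have hw : weight n i ^ 2 * (η ^ 2 / n i) =
      weight n i * η ^ 2 / ((∑ i, n i : ℕ) : ℝ) := by
    rcases (n i).eq_zero_or_pos with h | h
    · simp [weight, h]
    · rw [weight]
      field_simp
  set T := sampleOp H (x i)
  set A := localFilter H (x i) alg η
  calc ∑ j, ⟪weight n i • clientPsi H alg η (x i) j, f⟫_ℝ ^ 2
      = weight n i * η ^ 2 / ((∑ i, n i : ℕ) : ℝ) * ⟪(A * T * A) f, f⟫_ℝ := by
        simp only [real_inner_smul_left, mul_pow, ← Finset.mul_sum]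
        rw [sum_inner_clientPsi_sq (x i) (hA i).isSymmetric, ← mul_assoc, hw]
    _ ≤ weight n i * η ^ 2 / ((∑ i, n i : ℕ) : ℝ) * ⟪((alg.localSteps : ℝ) • (T * A)) f, f⟫_ℝ :=
        mul_le_mul_of_nonneg_left (inner_apply_self_le_of_le (hA i).mul_mul_le f)
          (div_nonneg (mul_nonneg (weight_nonneg n i) (sq_nonneg η)) (Nat.cast_nonneg _))
    _ = η * alg.localSteps / ((∑ i, n i : ℕ) : ℝ) *
          ⟪(weight n i • (1 - clientOp H alg η (x i))) f, f⟫_ℝ := by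
        rw [clientOp_eq (x i) alg hη, sub_sub_cancel]
        simp only [LinearMap.smul_apply, real_inner_smul_left]
        ring

end Global

section WellConditioned

variable {X H : Type*} [NormedAddCommGroup H] [InnerProductSpace ℝ H] [CompleteSpace H]
  [RKHS ℝ H X ℝ] {M : ℕ} {n : Fin M → ℕ}

/-- The deterministic properties of the covariates on which the convergence rests: the local
updates are stable (automatic for FedProx), the average of the sample operators is at least `a`,
and the sample operator of client `i` is at most `b i`. -/
structure IsWellConditioned (alg : Algorithm) (η a : ℝ) (b : Fin M → ℝ)
    (x : (i : Fin M) → Fin (n i) → X) : Prop where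
  gammaOf_lt_one : alg ≠ .fedProx → gammaOf H η x < 1
  smul_one_le : a • (1 : Module.End ℝ H) ≤ ∑ i, weight n i • sampleOp H (x i)
  sampleOp_le : ∀ i, sampleOp H (x i) ≤ b i • (1 : Module.End ℝ H)

namespace IsWellConditioned

variable {alg : Algorithm} {η a : ℝ} {b : Fin M → ℝ} {x : (i : Fin M) → Fin (n i) → X}
  [Nontrivial H]

theorem le_sum_weight_mul (h : IsWellConditioned (H := H) alg η a b x) :
    a ≤ (∑ i, weight n i) * ⨆ i, specNorm (gram H (x i)) := by
  refine le_of_smul_one_le_smul_one (H := H) (h.smul_one_le.trans ?_)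
  rw [Finset.sum_mul, Finset.sum_smul]
  refine Finset.sum_le_sum fun i _ => ?_
  rw [mul_smul]
  exact smul_le_smul_of_le (weight_nonneg n i)
    ((FedLearn.sampleOp_le (x i)).trans (smul_one_le_smul_one (specNorm_gram_le_iSup i)))

theorem sum_pos (h : IsWellConditioned (H := H) alg η a b x) (ha : 0 < a) : 0 < ∑ i, n i := by
  refine Nat.pos_of_ne_zero fun hzero => ?_
  have hle := h.le_sum_weight_mul
  simp only [weight, hzero, Nat.cast_zero, div_zero, Finset.sum_const_zero, zero_mul] at hle
  exact ha.not_ge hle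

theorem gammaOf_pos (h : IsWellConditioned (H := H) alg η a b x) (hη : 0 < η) (ha : 0 < a) :
    0 < gammaOf H η x := by
  have hle := h.le_sum_weight_mul
  rw [sum_weight (h.sum_pos ha), one_mul] at hle
  exact mul_pos hη (ha.trans_le hle)

theorem kappa_pos (h : IsWellConditioned (H := H) alg η a b x) (hη : 0 < η) (ha : 0 < a)
    (hs : 1 ≤ alg.localSteps) : 0 < alg.kappa (gammaOf H η x) :=
  FedLearn.kappa_pos (h.gammaOf_pos hη ha) hs h.gammaOf_lt_one

theorem rate_pos (h : IsWellConditioned (H := H) alg η a b x) (hη : 0 < η) (ha : 0 < a)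
    (hs : 1 ≤ alg.localSteps) : 0 < alg.localSteps * η * a / alg.kappa (gammaOf H η x) :=
  div_pos (mul_pos (mul_pos (Nat.cast_pos.mpr hs) hη) ha) (h.kappa_pos hη ha hs)

theorem bound_nonneg (h : IsWellConditioned (H := H) alg η a b x) (i : Fin M) : 0 ≤ b i := by
  refine le_of_smul_one_le_smul_one (H := H) ?_
  rw [zero_smul]
  exact (sampleOp_nonneg (x i)).trans (h.sampleOp_le i)

variable [FiniteDimensional ℝ H]

theorem isLocalFilter (h : IsWellConditioned (H := H) alg η a b x) (hη : 0 < η) (ha : 0 < a)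
    (i : Fin M) : IsLocalFilter η alg.localSteps (alg.kappa (gammaOf H η x))
      (sampleOp H (x i)) (localFilter H (x i) alg η) :=
  isLocalFilter_localFilter (x i) hη.le (h.gammaOf_pos hη ha)
    (fun halg => (h.gammaOf_lt_one halg).le)
    (mul_le_mul_of_nonneg_left (specNorm_gram_le_iSup i) hη.le)

theorem smul_one_le_one_sub_globalOp (h : IsWellConditioned (H := H) alg η a b x) (hη : 0 < η)
    (ha : 0 < a) (hs : 1 ≤ alg.localSteps) :
    (alg.localSteps * η * a / alg.kappa (gammaOf H η x)) • (1 : Module.End ℝ H) ≤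
      1 - globalOp H alg η x :=
  FedLearn.smul_one_le_one_sub_globalOp hη.le (h.kappa_pos hη ha hs).le (h.sum_pos ha)
    (h.isLocalFilter hη ha) h.smul_one_le

theorem isUnit_one_sub_globalOp (h : IsWellConditioned (H := H) alg η a b x) (hη : 0 < η)
    (ha : 0 < a) (hs : 1 ≤ alg.localSteps) : IsUnit (1 - globalOp H alg η x) :=
  isUnit_of_smul_one_le (h.rate_pos hη ha hs) (h.smul_one_le_one_sub_globalOp hη ha hs)

theorem integrable_and_integral_norm_globalModel_sub_sq_le
    (h : IsWellConditioned (H := H) alg η a b x) (hη : 0 < η) (ha : 0 < a)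
    (hs : 1 ≤ alg.localSteps) {σ : ℝ} {P : Measure ((Σ i : Fin M, Fin (n i)) → ℝ)}
    [IsProbabilityMeasure P] (hP : IsNoiseLaw σ P) (fStar : Fin M → H) (f₀ : H) (t : ℕ) :
    Integrable (fun ξ =>
      ‖globalModel alg η x (responses x fStar ξ) f₀ t - fBar alg η x fStar‖ ^ 2) P ∧
    ∫ ξ, ‖globalModel alg η x (responses x fStar ξ) f₀ t - fBar alg η x fStar‖ ^ 2 ∂P ≤
      (1 - alg.localSteps * η * a / alg.kappa (gammaOf H η x)) ^ (2 * t) *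
          ‖f₀ - fBar alg η x fStar‖ ^ 2 +
        σ ^ 2 * (alg.kappa (gammaOf H η x) * Module.finrank ℝ H /
          (((∑ i, n i : ℕ) : ℝ) * a)) := by
  have hL := globalOp_nonneg hη.le (h.isLocalFilter hη ha)
  have hLρ := h.smul_one_le_one_sub_globalOp hη ha hs
  have hρ := h.rate_pos hη ha hs
  have hκ := h.kappa_pos hη ha hs
  simp only [globalModel_sub_fBar hη (h.isUnit_one_sub_globalOp hη ha hs)]
  refine (hP.integrable_and_integral_norm_sq_le _ _).imp_right fun hle => hle.trans ?_
  refine add_le_add (norm_pow_apply_sq_le hL hLρ t _)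
    (mul_le_mul_of_nonneg_left ?_ (sq_nonneg σ))
  refine (sum_norm_sum_pow_apply_sq_le hL hρ hLρ (by positivity)
    (sum_inner_weight_smul_clientPsi_sq_le hη.le (h.sum_pos ha) (h.isLocalFilter hη ha)) t).trans_eq
      ?_
  have hs' : (alg.localSteps : ℝ) ≠ 0 := (Nat.cast_pos.mpr hs).ne'
  field_simp

theorem norm_fBar_sub_le (h : IsWellConditioned (H := H) alg η a b x) (hη : 0 < η) (ha : 0 < a)
    (hs : 1 ≤ alg.localSteps) (fStar : Fin M → H) (j : Fin M) :
    ‖fBar alg η x fStar - fStar j‖ ≤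
      modelGap fStar * √(alg.kappa (gammaOf H η x) / a * ∑ i, weight n i * b i) := by
  have hA := h.isLocalFilter hη ha
  have hκ := h.kappa_pos hη ha hs
  have hgap := modelGap_nonneg fStar
  have hclient (i : Fin M) :
      ⟪(1 - clientOp H alg η (x i)) (fStar i - fStar j), fStar i - fStar j⟫_ℝ ≤
        alg.localSteps * η * b i * modelGap fStar ^ 2 := by
    have := h.bound_nonneg i
    refine (inner_one_sub_clientOp_le hη.le (hA i) (h.sampleOp_le i) _).trans ?_
    gcongr
    exact norm_sub_le_modelGap fStar i j
  have henergy := calc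
    alg.localSteps * η * a / alg.kappa (gammaOf H η x) * ‖fBar alg η x fStar - fStar j‖ ^ 2
      ≤ ⟪(1 - globalOp H alg η x) (fBar alg η x fStar - fStar j),
          fBar alg η x fStar - fStar j⟫_ℝ := by
        simpa only [inner_smul_one_apply_self] using inner_apply_self_le_of_le
          (h.smul_one_le_one_sub_globalOp hη ha hs) (fBar alg η x fStar - fStar j)
    _ ≤ ∑ i, weight n i *
          ⟪(1 - clientOp H alg η (x i)) (fStar i - fStar j), fStar i - fStar j⟫_ℝ :=
        inner_one_sub_globalOp_fBar_sub_le hη.le (h.sum_pos ha) (fun i => (hA i).commute)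
          (fun i => clientOp_le_one hη.le hκ.le (hA i)) (h.isUnit_one_sub_globalOp hη ha hs) fStar _
    _ ≤ ∑ i, weight n i * (alg.localSteps * η * b i * modelGap fStar ^ 2) :=
        Finset.sum_le_sum fun i _ => mul_le_mul_of_nonneg_left (hclient i) (weight_nonneg n i)
    _ = alg.localSteps * η * a / alg.kappa (gammaOf H η x) * (modelGap fStar ^ 2 *
          (alg.kappa (gammaOf H η x) / a * ∑ i, weight n i * b i)) := by
        simp only [Finset.mul_sum]
        refine Finset.sum_congr rfl fun i _ => ?_
        field_simp
  refine (Real.le_sqrt_of_sq_le (le_of_mul_le_mul_left henergy (h.rate_pos hη ha hs))).trans_eq ?_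
  rw [Real.sqrt_mul (sq_nonneg _), Real.sqrt_sq hgap]

end IsWellConditioned

end WellConditioned

section Features

theorem minEigenvalue_mul_le {m : ℕ} {A : Matrix (Fin m) (Fin m) ℝ} (hA : A.IsHermitian)
    (v : Fin m → ℝ) : minEigenvalue A * (v ⬝ᵥ v) ≤ v ⬝ᵥ (A *ᵥ v) := by
  open scoped MatrixOrder in
  have hle : algebraMap ℝ _ (minEigenvalue A) ≤ A :=
    (algebraMap_le_iff_le_spectrum (R := ℝ) (ha := hA.isSelfAdjoint)).mpr fun a ha =>
      csInf_le A.finite_real_spectrum.bddBelow ha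
  have hpos := (Matrix.le_iff.mp hle).dotProduct_mulVec_nonneg v
  simpa only [star_trivial, sub_mulVec, dotProduct_sub, sub_nonneg, Algebra.algebraMap_eq_smul_one,
    smul_mulVec, one_mulVec, dotProduct_smul, smul_eq_mul] using hpos

theorem isHermitian_smul_transpose_mul_self {n r : ℕ} (c : ℝ) (F : Matrix (Fin n) (Fin r) ℝ) :
    (c • (Fᵀ * F)).IsHermitian := by
  simp [Matrix.IsHermitian, conjTranspose_eq_transpose_of_trivial]

theorem IsConditioned.pos {α β : ℝ} {n r : ℕ} {F : Matrix (Fin n) (Fin r) ℝ}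
    (hF : IsConditioned α β F) (hα : 0 < α) (hr : 0 < r) : 0 < n := by
  refine Nat.pos_of_ne_zero fun hn => ?_
  subst hn
  have hle := minEigenvalue_mul_le
    (isHermitian_smul_transpose_mul_self (1 / ((0 : ℕ) : ℝ)) F) (fun _ => 1)
  have hr' : (0 : ℝ) < (fun _ : Fin r => (1 : ℝ)) ⬝ᵥ (fun _ => 1) := by
    simpa [dotProduct] using hr
  refine (mul_pos (hα.trans_le hF.1) hr').not_ge (hle.trans_eq ?_)
  simp

theorem pos_of_transpose_mul_self_eq_one {d r : ℕ} {U : Matrix (Fin d) (Fin r) ℝ}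
    (hU : Uᵀ * U = 1) (hr : 0 < r) : 0 < d := by
  refine Nat.pos_of_ne_zero fun hd => ?_
  subst hd
  simpa [mul_apply] using congrFun₂ hU ⟨0, hr⟩ ⟨0, hr⟩

theorem isStarProjection_mul_transpose {d r : ℕ} {U : Matrix (Fin d) (Fin r) ℝ}
    (hU : Uᵀ * U = 1) : IsStarProjection (U * Uᵀ) where
  isIdempotentElem := by
    rw [IsIdempotentElem, Matrix.mul_assoc, ← Matrix.mul_assoc Uᵀ, hU, Matrix.one_mul]
  isSelfAdjoint := by
    simp [isSelfAdjoint_iff, star_eq_conjTranspose, conjTranspose_eq_transpose_of_trivial]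

theorem dotProduct_transpose_mulVec_self {d r : ℕ} (U : Matrix (Fin d) (Fin r) ℝ)
    (v : Fin d → ℝ) : (Uᵀ *ᵥ v) ⬝ᵥ (Uᵀ *ᵥ v) = v ⬝ᵥ ((U * Uᵀ) *ᵥ v) := by
  rw [← mulVec_mulVec, dotProduct_mulVec v, ← mulVec_transpose]

theorem dotProduct_mulVec_le_of_isStarProjection {d : ℕ} {P : Matrix (Fin d) (Fin d) ℝ}
    (hP : IsStarProjection P) (v : Fin d → ℝ) : v ⬝ᵥ (P *ᵥ v) ≤ v ⬝ᵥ v := by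
  open scoped MatrixOrder in
  have hpos := (Matrix.le_iff.mp hP.le_one).dotProduct_mulVec_nonneg v
  simpa only [star_trivial, sub_mulVec, dotProduct_sub, sub_nonneg, one_mulVec] using hpos

theorem dotProduct_repr_self {d : ℕ} {H : Type*} [NormedAddCommGroup H] [InnerProductSpace ℝ H]
    (b : OrthonormalBasis (Fin d) ℝ H) (f : H) : (b.repr f).ofLp ⬝ᵥ (b.repr f).ofLp = ‖f‖ ^ 2 := by
  rw [← b.repr.norm_map f, EuclideanSpace.real_norm_sq_eq]
  simp [dotProduct, pow_two]

variable {X H : Type*} [NormedAddCommGroup H] [InnerProductSpace ℝ H] [CompleteSpace H]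
  [RKHS ℝ H X ℝ] {d m r : ℕ} (b : OrthonormalBasis (Fin d) ℝ H)

theorem featureMatrix_mulVec (x : Fin m → X) (f : H) (j : Fin m) :
    (featureMatrix b x *ᵥ (b.repr f).ofLp) j = f (x j) := by
  conv_rhs => rw [← inner_rep_left, ← b.sum_repr f, inner_sum]
  simp [mulVec, dotProduct, featureMatrix, inner_smul_right, inner_rep_left, mul_comm]

variable {b} {x : Fin m → X} {F : Matrix (Fin m) (Fin r) ℝ} {U : Matrix (Fin d) (Fin r) ℝ}
  {c α β : ℝ}

theorem inner_sampleOp_of_featureMatrix_eq (hx : featureMatrix b x = c • (F * Uᵀ)) (f : H) :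
    ⟪sampleOp H x f, f⟫_ℝ = c ^ 2 * ((Uᵀ *ᵥ (b.repr f).ofLp) ⬝ᵥ
      (((1 / (m : ℝ)) • (Fᵀ * F)) *ᵥ (Uᵀ *ᵥ (b.repr f).ofLp))) := by
  rw [inner_sampleOp]
  simp only [← featureMatrix_mulVec b x f, hx, smul_mulVec, ← mulVec_mulVec, Pi.smul_apply,
    smul_eq_mul, dotProduct_smul]
  generalize Uᵀ *ᵥ (b.repr f).ofLp = u
  have hsq : u ⬝ᵥ (Fᵀ *ᵥ (F *ᵥ u)) = ∑ j, (F *ᵥ u) j * (F *ᵥ u) j := by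
    rw [dotProduct_mulVec, vecMul_transpose]
    rfl
  rw [hsq, Finset.mul_sum, Finset.mul_sum, Finset.mul_sum]
  exact Finset.sum_congr rfl fun j _ => by ring

theorem IsConditioned.le_inner_sampleOp (hF : IsConditioned α β F)
    (hx : featureMatrix b x = c • (F * Uᵀ)) (f : H) :
    c ^ 2 * (α * ((b.repr f).ofLp ⬝ᵥ ((U * Uᵀ) *ᵥ (b.repr f).ofLp))) ≤
      ⟪sampleOp H x f, f⟫_ℝ := by
  rw [inner_sampleOp_of_featureMatrix_eq hx, ← dotProduct_transpose_mulVec_self]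
  have hnonneg := dotProduct_self_star_nonneg (Uᵀ *ᵥ (b.repr f).ofLp)
  exact mul_le_mul_of_nonneg_left ((mul_le_mul_of_nonneg_right hF.1 hnonneg).trans
      (minEigenvalue_mul_le (isHermitian_smul_transpose_mul_self _ F) _)) (sq_nonneg c)

theorem IsConditioned.sampleOp_le (hF : IsConditioned α β F)
    (hx : featureMatrix b x = c • (F * Uᵀ)) (hU : Uᵀ * U = 1) :
    sampleOp H x ≤ (c ^ 2 * β) • (1 : Module.End ℝ H) := by
  refine le_of_inner_apply_self_le (isSymmetric_of_nonneg (sampleOp_nonneg x))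
    (isSymmetric_smul_one _) fun f => ?_
  rw [inner_sampleOp_of_featureMatrix_eq hx, inner_smul_one_apply_self, mul_assoc]
  have hβ : 0 ≤ β := (norm_nonneg _).trans hF.2
  refine mul_le_mul_of_nonneg_left ((dotProduct_mulVec_le_specNorm _ _).trans
    (mul_le_mul hF.2 ?_ (dotProduct_self_star_nonneg _) hβ)) (sq_nonneg c)
  rw [dotProduct_transpose_mulVec_self, ← dotProduct_repr_self b]
  exact dotProduct_mulVec_le_of_isStarProjection (isStarProjection_mul_transpose hU) _

end Features

section Subspaces

variable {X H : Type*} [NormedAddCommGroup H] [InnerProductSpace ℝ H] [CompleteSpace H]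
  [RKHS ℝ H X ℝ] {d M : ℕ} {n r : Fin M → ℕ} {b : OrthonormalBasis (Fin d) ℝ H}

theorem isWellConditioned_of_half_le_sum {x : (i : Fin M) → Fin (n i) → X}
    {F : (i : Fin M) → Matrix (Fin (n i)) (Fin (r i)) ℝ}
    {U : (i : Fin M) → Matrix (Fin d) (Fin (r i)) ℝ} {alg : Algorithm} {η α β : ℝ} (hα : 0 ≤ α)
    (hγ : alg ≠ .fedProx → gammaOf H η x < 1)
    (hx : ∀ i, featureMatrix b (x i) = √((d : ℝ) / r i) • (F i * (U i)ᵀ))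
    (hF : ∀ i, IsConditioned α β (F i)) (hU : ∀ i, (U i)ᵀ * U i = 1)
    (hhalf : ∀ v, 1 / 2 * (v ⬝ᵥ v) ≤
      ∑ i, weight n i * ((d : ℝ) / r i) * (v ⬝ᵥ ((U i * (U i)ᵀ) *ᵥ v))) :
    IsWellConditioned (H := H) alg η (α / 2) (fun i => (d : ℝ) / r i * β) x where
  gammaOf_lt_one := hγ
  smul_one_le := by
    have hnonneg : 0 ≤ ∑ i, weight n i • sampleOp H (x i) :=
      Finset.sum_nonneg fun i _ => by
        simpa only [smul_zero] using smul_le_smul_of_le (weight_nonneg n i)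
          (sampleOp_nonneg (H := H) (x i))
    refine le_of_inner_apply_self_le (isSymmetric_smul_one _) (isSymmetric_of_nonneg hnonneg)
      fun f => ?_
    rw [inner_smul_one_apply_self, ← dotProduct_repr_self b]
    set v := (b.repr f).ofLp
    calc α / 2 * (v ⬝ᵥ v) = α * (1 / 2 * (v ⬝ᵥ v)) := by ring
      _ ≤ α * ∑ i, weight n i * ((d : ℝ) / r i) * (v ⬝ᵥ ((U i * (U i)ᵀ) *ᵥ v)) :=
        mul_le_mul_of_nonneg_left (hhalf v) hα
      _ = ∑ i, weight n i * (√((d : ℝ) / r i) ^ 2 * (α * (v ⬝ᵥ ((U i * (U i)ᵀ) *ᵥ v)))) := by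
        rw [Finset.mul_sum]
        refine Finset.sum_congr rfl fun i _ => ?_
        rw [Real.sq_sqrt (by positivity)]
        ring
      _ ≤ ∑ i, weight n i * ⟪sampleOp H (x i) f, f⟫_ℝ := by
        gcongr with i
        · exact weight_nonneg n i
        · exact (hF i).le_inner_sampleOp (hx i) f
      _ = ⟪(∑ i, weight n i • sampleOp H (x i)) f, f⟫_ℝ := by
        simp only [LinearMap.sum_apply, LinearMap.smul_apply, sum_inner, real_inner_smul_left]
  sampleOp_le i := by
    simpa only [Real.sq_sqrt (show (0 : ℝ) ≤ d / r i by positivity)] using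
      (hF i).sampleOp_le (hx i) (hU i)

theorem sum_weight_mul_le {β ν : ℝ} (hβ : 0 ≤ β) (hν : ∀ i, (n i : ℝ) / r i ≤ ν) :
    ∑ i, weight n i * ((d : ℝ) / r i * β) ≤ M * (ν * d * β / ((∑ i, n i : ℕ) : ℝ)) := by
  have hterm (i : Fin M) :
      weight n i * ((d : ℝ) / r i * β) ≤ ν * d * β / ((∑ i, n i : ℕ) : ℝ) := by
    calc weight n i * ((d : ℝ) / r i * β)
        = (n i : ℝ) / r i * d * β / ((∑ i, n i : ℕ) : ℝ) := by rw [weight]; ring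
      _ ≤ ν * d * β / ((∑ i, n i : ℕ) : ℝ) := by gcongr; exact hν i
  simpa using Finset.sum_le_sum fun i (_ : i ∈ Finset.univ) => hterm i

theorem IsWellConditioned.norm_fBar_sub_le_of_div_le [FiniteDimensional ℝ H] [Nontrivial H]
    {x : (i : Fin M) → Fin (n i) → X} {alg : Algorithm} {η α β ν : ℝ}
    (h : IsWellConditioned (H := H) alg η (α / 2) (fun i => (d : ℝ) / r i * β) x) (hη : 0 < η)
    (hα : 0 < α) (hs : 1 ≤ alg.localSteps) (hβ : 0 ≤ β) (hν : ∀ i, (n i : ℝ) / r i ≤ ν)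
    (fStar : Fin M → H) (j : Fin M) :
    ‖fBar alg η x fStar - fStar j‖ ≤ modelGap fStar *
      √(2 * alg.kappa (gammaOf H η x) * β * ν * M * d / (α * ((∑ i, n i : ℕ) : ℝ))) := by
  have hκ := h.kappa_pos hη (half_pos hα) hs
  refine (h.norm_fBar_sub_le hη (half_pos hα) hs fStar j).trans
    (mul_le_mul_of_nonneg_left (Real.sqrt_le_sqrt ?_) (modelGap_nonneg fStar))
  refine (mul_le_mul_of_nonneg_left (sum_weight_mul_le hβ hν) (by positivity)).trans_eq ?_
  field_simp

theorem mul_exp_neg_one_div_le {D R : ℝ} (hD : 0 < D) (hR : 0 < R)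
    (h : 40 * R * Real.log D ≤ 1) : D * Real.exp (-(1 / (20 * R))) ≤ 1 / D := by
  have hlog : Real.log D + Real.log D ≤ 1 / (20 * R) := by
    rw [le_div_iff₀ (by positivity)]
    linarith
  calc D * Real.exp (-(1 / (20 * R)))
      ≤ D * Real.exp (-(Real.log D + Real.log D)) := by gcongr
    _ = 1 / D := by
      rw [Real.exp_neg, Real.exp_add, Real.exp_log hD]
      field_simp

end Subspaces

section Probability

attribute [local instance] matrixMeasurableSpace matrixBorelSpace matrixSecondCountableTopology

theorem exists_measurableSet_forall_mem_of_ae {Ω : Type*} [MeasurableSpace Ω] {μ : Measure Ω}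
    {E : Set Ω} {p : Ω → Prop} (hE : MeasurableSet E) (h : ∀ᵐ ω ∂μ, ω ∈ E → p ω) :
    ∃ E' : Set Ω, MeasurableSet E' ∧ μ.real E' = μ.real E ∧ ∀ ω ∈ E', p ω := by
  have hae : E =ᵐ[μ] {ω ∈ E | p ω} :=
    h.mono fun ω hω => propext ⟨fun hmem => ⟨hmem, hω hmem⟩, And.left⟩
  obtain ⟨E', hsub, hE', hae'⟩ :=
    (hE.nullMeasurableSet.congr hae).exists_measurable_subset_ae_eq
  exact ⟨E', hE', measureReal_congr (hae'.trans hae.symm), fun ω hω => (hsub hω).2⟩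

namespace IsSubspaceModel

variable {X H Ω : Type*} [NormedAddCommGroup H] [InnerProductSpace ℝ H]
  [RKHS ℝ H X ℝ] [MeasurableSpace Ω] {μ : Measure Ω} {d M : ℕ} {n r : Fin M → ℕ}
  {b : OrthonormalBasis (Fin d) ℝ H} {x : Ω → (i : Fin M) → Fin (n i) → X}
  {U : (i : Fin M) → Ω → Matrix (Fin d) (Fin (r i)) ℝ}
  {F : (i : Fin M) → Ω → Matrix (Fin (n i)) (Fin (r i)) ℝ}

theorem isIsotropicProjection (h : IsSubspaceModel μ b x U F) (i : Fin M) :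
    IsIsotropicProjection μ ((r i : ℝ) / d) fun ω => U i ω * (U i ω)ᵀ where
  measurable := measurable_pi_lambda _ fun k => measurable_pi_lambda _ fun l => by
    simp only [mul_apply, transpose_apply]
    exact Finset.measurable_fun_sum _ fun a _ => (h.measurable i k a).mul (h.measurable i l a)
  isStarProjection := h.orthonormal.mono fun _ hω => isStarProjection_mul_transpose (hω i)
  mean := h.isotropic i

theorem iIndepFun_mul_transpose (h : IsSubspaceModel μ b x U F) :
    iIndepFun (fun i ω => U i ω * (U i ω)ᵀ) μ :=
  h.indep.comp (fun _ v => Matrix.of fun k l => v (k, l)) fun _ =>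
    measurable_pi_lambda _ fun k => measurable_pi_lambda _ fun l => measurable_pi_apply (k, l)

variable [IsProbabilityMeasure μ]

theorem exists_half_le_sum (h : IsSubspaceModel μ b x U F) (hd : 0 < d) (hr : ∀ i, 0 < r i)
    (hn : 0 < ∑ i, n i) {ν : ℝ} (hν : ∀ i, (n i : ℝ) / r i ≤ ν)
    (hN : 40 * ν * d * Real.log d ≤ ((∑ i, n i : ℕ) : ℝ)) :
    ∃ E : Set Ω, MeasurableSet E ∧ 1 - 1 / (d : ℝ) ≤ μ.real E ∧
      ∀ᵐ ω ∂μ, ω ∈ E → ∀ v, 1 / 2 * (v ⬝ᵥ v) ≤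
        ∑ i, weight n i * ((d : ℝ) / r i) * (v ⬝ᵥ ((U i ω * (U i ω)ᵀ) *ᵥ v)) := by
  have hd' : (0 : ℝ) < d := Nat.cast_pos.mpr hd
  have hr' (i : Fin M) : (0 : ℝ) < r i := Nat.cast_pos.mpr (hr i)
  have hN' : (0 : ℝ) < (∑ i, n i : ℕ) := Nat.cast_pos.mpr hn
  have hν' : 0 < ν := by
    obtain ⟨i, -, hi⟩ := Finset.sum_pos_iff.mp hn
    exact (div_pos (Nat.cast_pos.mpr hi) (hr' i)).trans_le (hν i)
  have hsum : ∑ i, weight n i * ((d : ℝ) / r i) * ((r i : ℝ) / d) = 1 := by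
    rw [← sum_weight hn]
    refine Finset.sum_congr rfl fun i _ => ?_
    have := (hr' i).ne'
    field_simp
  have hbound (i : Fin M) : weight n i * ((d : ℝ) / r i) ≤ ν * d / (∑ i, n i : ℕ) := by
    calc weight n i * ((d : ℝ) / r i) = (n i : ℝ) / r i * d / (∑ i, n i : ℕ) := by
          rw [weight]; ring
      _ ≤ ν * d / (∑ i, n i : ℕ) := by gcongr; exact hν i
  have hR : 0 < ν * d / ((∑ i, n i : ℕ) : ℝ) := by positivity
  obtain ⟨E, hE, hμE, hhalf⟩ := exists_half_le_sum_projections h.isIsotropicProjection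
    h.iIndepFun_mul_transpose (fun i => by positivity)
    (fun i => mul_nonneg (weight_nonneg n i) (by positivity)) hsum hR hbound
  refine ⟨E, hE, le_trans ?_ hμE, hhalf⟩
  rw [Fintype.card_fin]
  refine sub_le_sub_left (mul_exp_neg_one_div_le hd' hR ?_) 1
  calc 40 * (ν * d / (∑ i, n i : ℕ)) * Real.log d
      = 40 * ν * d * Real.log d / (∑ i, n i : ℕ) := by ring
    _ ≤ 1 := (div_le_one hN').mpr hN

theorem exists_isWellConditioned [CompleteSpace H] (h : IsSubspaceModel μ b x U F) (hd : 0 < d)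
    (hr : ∀ i, 0 < r i) (hn : 0 < ∑ i, n i) {alg : Algorithm} {η α β ν : ℝ} (hα : 0 ≤ α)
    (hF : ∀ᵐ ω ∂μ, ∀ i, IsConditioned α β (F i ω))
    (hγ : alg ≠ .fedProx → ∀ᵐ ω ∂μ, gammaOf H η (x ω) < 1) (hν : ∀ i, (n i : ℝ) / r i ≤ ν)
    (hN : 40 * ν * d * Real.log d ≤ ((∑ i, n i : ℕ) : ℝ)) :
    ∃ E : Set Ω, MeasurableSet E ∧ 1 - 1 / (d : ℝ) ≤ μ.real E ∧ ∀ᵐ ω ∂μ, ω ∈ E →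
      IsWellConditioned (H := H) alg η (α / 2) (fun i => (d : ℝ) / r i * β) (x ω) := by
  obtain ⟨E, hE, hμE, hhalf⟩ := h.exists_half_le_sum hd hr hn hν hN
  refine ⟨E, hE, hμE, ?_⟩
  filter_upwards [hhalf, h.factor, hF, h.orthonormal, Filter.eventually_imp_distrib_left.mpr hγ]
    with ω hhalfω hx hFω hU hγω hω
  exact isWellConditioned_of_half_le_sum hα hγω hx hFω hU (hhalfω hω)

end IsSubspaceModel

end Probability

end FedLearn

theorem mainTheorem7 :
    ∃ C : ℝ, 0 < C ∧
      ∀ {X H Ω : Type*} [NormedAddCommGroup H] [InnerProductSpace ℝ H] [CompleteSpace H]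
        [RKHS ℝ H X ℝ] [MeasurableSpace Ω] (μ : Measure Ω) [IsProbabilityMeasure μ]
        -- the dimension and the orthonormal basis of `H` that forms the feature map
        (d : ℕ) (b : OrthonormalBasis (Fin d) ℝ H)
        -- clients, local data volumes, local subspace dimensions
        (M : ℕ) (_ : 0 < M) (n r : Fin M → ℕ) (_ : ∀ i, 0 < r i)
        -- algorithm, stepsize, initial model, true models, noise level, conditioning
        (alg : FedLearn.Algorithm) (_ : 1 ≤ alg.localSteps) (η : ℝ) (_ : 0 < η)
        (f₀ : H) (fStar : Fin M → H) (σ α β : ℝ) (_ : 0 < α) (_ : 0 < β)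
        -- random covariates, and the conditional law of the noise given the covariates
        (x : Ω → (i : Fin M) → Fin (n i) → X)
        (Q : Kernel Ω ((Σ i : Fin M, Fin (n i)) → ℝ)) [IsMarkovKernel Q]
        (_ : ∀ᵐ ω ∂μ, FedLearn.IsNoiseLaw σ (Q ω))
        -- the subspace model
        (U : (i : Fin M) → Ω → Matrix (Fin d) (Fin (r i)) ℝ)
        (F : (i : Fin M) → Ω → Matrix (Fin (n i)) (Fin (r i)) ℝ)
        (_ : FedLearn.IsSubspaceModel μ b x U F)
        (_ : ∀ᵐ ω ∂μ, ∀ i, FedLearn.IsConditioned α β (F i ω))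
        -- standing assumption `γ < 1`, not needed for FedProx
        (_ : alg ≠ .fedProx → ∀ᵐ ω ∂μ, FedLearn.gammaOf H η (x ω) < 1)
        (N : ℕ) (_ : N = ∑ i, n i) (ν : ℝ) (_ : ν = ⨆ i, (n i : ℝ) / (r i : ℝ))
        (_ : C * ν * d * Real.log d ≤ N),
        ∃ E : Set Ω, MeasurableSet E ∧ 1 - 1 / (d : ℝ) ≤ μ.real E ∧
          ∀ ω ∈ E, ∀ κ : ℝ, κ = alg.kappa (FedLearn.gammaOf H η (x ω)) →
            ∀ θbar : EuclideanSpace ℝ (Fin d),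
              θbar = b.repr (FedLearn.fBar alg η (x ω) fStar) →
            ∀ θ : ℕ → ((Σ i : Fin M, Fin (n i)) → ℝ) → EuclideanSpace ℝ (Fin d),
              θ = (fun t ξ => b.repr (FedLearn.globalModel alg η (x ω)
                (FedLearn.responses (x ω) fStar ξ) f₀ t)) →
            IsUnit (1 - FedLearn.globalOp H alg η (x ω)) ∧
            (∀ t : ℕ,
              Integrable (fun ξ => ‖θ t ξ - θbar‖ ^ 2) (Q ω) ∧
              ∫ ξ, ‖θ t ξ - θbar‖ ^ 2 ∂(Q ω) ≤
                (1 - alg.localSteps * η * α / (2 * κ)) ^ (2 * t) * ‖b.repr f₀ - θbar‖ ^ 2 +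
                  σ ^ 2 * (2 * κ * d / (N * α))) ∧
            ∀ j : Fin M,
              ‖θbar - b.repr (fStar j)‖ ≤
                FedLearn.modelGap fStar * √(2 * κ * β * ν * M * d / (α * N)) := by
  refine ⟨40, by norm_num, ?_⟩
  intro X H Ω _ _ _ _ _ μ _ d b M hM n r hr alg hs η hη f₀ fStar σ α β hα hβ x Q _ hQ U F hU hF hγ
    N hN ν hν hCN
  obtain ⟨ω₀, hF₀, hU₀⟩ := (hF.and hU.orthonormal).exists
  have hd : 0 < d := FedLearn.pos_of_transpose_mul_self_eq_one (hU₀ ⟨0, hM⟩) (hr _)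
  have hn : 0 < ∑ i, n i :=
    Finset.sum_pos (fun i _ => (hF₀ i).pos hα (hr i)) ⟨⟨0, hM⟩, Finset.mem_univ _⟩
  have hνi (i) : (n i : ℝ) / r i ≤ ν :=
    hν ▸ le_ciSup (f := fun i => (n i : ℝ) / (r i : ℝ)) (Set.finite_range _).bddAbove i
  have : FiniteDimensional ℝ H := b.toBasis.finiteDimensional_of_finite
  have hrank : Module.finrank ℝ H = d := by simpa using Module.finrank_eq_card_basis b.toBasis
  have : Nontrivial H := Module.nontrivial_of_finrank_pos (R := ℝ) (hrank ▸ hd)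
  obtain ⟨E, hE, hμE, hgood⟩ := hU.exists_isWellConditioned hd hr hn hα.le hF hγ hνi (hN ▸ hCN)
  obtain ⟨E', hE', hμE', hE'good⟩ := FedLearn.exists_measurableSet_forall_mem_of_ae hE
    ((hgood.and hQ).mono fun ω h hω => And.intro (h.1 hω) h.2)
  refine ⟨E', hE', hμE.trans_eq hμE'.symm, ?_⟩
  rintro ω hω κ rfl θbar rfl θ rfl
  obtain ⟨hx, hP⟩ := hE'good ω hω
  simp only [← map_sub, LinearIsometryEquiv.norm_map]
  refine ⟨hx.isUnit_one_sub_globalOp hη (half_pos hα) hs, fun t => ?_, fun j =>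
    hN ▸ hx.norm_fBar_sub_le_of_div_le hη hα hs hβ.le hνi fStar j⟩
  have hrate (κ : ℝ) : alg.localSteps * η * α / (2 * κ) = alg.localSteps * η * (α / 2) / κ := by
    ring
  rw [hrate]
  convert hx.integrable_and_integral_norm_globalModel_sub_sq_le hη (half_pos hα) hs hP fStar f₀ t
    using 4
  rw [hrank, ← hN]
  ring
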